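/- For $h$ on $\mathbb R^d$ let $\widehat h(\xi)=\int_{\mathbb R^d}h(x)e^{-ix\cdot\xi}\,dx$, extended to tempered distributions. For $s\ge 0$ put $\phi_s(r)=\sqrt{s^2+r^2}$, and for a function $f$ on $\mathbb R^d$ whose Fourier transform $\widehat f$ belongs to $L^1(\mathbb R^d)+L^2(\mathbb R^d)$ let $u=e^{it\phi_s(\sqrt{-\Delta})}f$ be the measurable function of $(t,x)$ such that, for every $t$, $u(t,\cdot)$ has Fourier transform $e^{it\phi_s(|\xi|)}\widehat f(\xi)$; thus $u(t,x)=(2\pi)^{-d}\int\widehat f(\xi)e^{ix\cdot\xi+it\phi_s(|\xi|)}\,d\xi$ if $\widehat f\in L^1$. Let $$K_s(y_1,y_2)=\frac{\left(\phi_s(|y_1|)\phi_s(|y_2|)-y_1\cdot y_2-s^2\right)^{\frac{d-2}{2}}}{\left(\phi_s(|y_1|)\phi_s(|y_2|)-y_1\cdot y_2+s^2\right)^{\frac12}},\qquad \mathbf{KG}(d)=\frac{2^{-\frac{d-1}{2}}|\mathbb S^{d-1}|}{(2\pi)^{3d-1}},$$ where $|\mathbb S^{d-1}|$ is the surface measure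 of the unit sphere of $\mathbb R^d$ ($|\mathbb S^0|=2$). All norms and integrals below take values in $[0,\infty]$. **Theorem 1.** (i) Let $d\ge 2$ and $s\ge 0$. If $\widehat{f_1},\widehat{f_2}\in L^1(\mathbb R^d)+L^2(\mathbb R^d)$, then $$\left\|e^{it\phi_s(\sqrt{-\Delta})}f_1\,e^{it\phi_s(\sqrt{-\Delta})}f_2\right\|_{L^2(\mathbb R^{d+1})}^2\le \mathbf{KG}(d)\int_{\mathbb R^{2d}}|\widehat{f_1}(y_1)|^2|\widehat{f_2}(y_2)|^2\phi_s(|y_1|)\phi_s(|y_2|)K_s(y_1,y_2)\,dy_1\,dy_2 .$$ For every $a>0$ there is an $f$ with $\widehat f(\xi)=e^{-a\phi_s(|\xi|)}/\phi_s(|\xi|)$, and equality holds for $f_1=f_2=f$. If $(d,s)\ne(2,0)$, then both sides of this equality are finite and non-zero, and the constant $\mathbf{KG}(d)$ is best possible: for these $d$ and $s$ the inequality fails for some $f_1,f_2$ if $\mathbf{KG}(d)$ is replaced by a smaller constant. (ii) Let $d=1$ and $\widehat{f_1},\widehat{f_2}\in L^1(\mathbb R)+L^2(\mathbb R)$. Suppose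 either that $s>0$ and $\widehat{f_1},\widehat{f_2}$ have disjoint supports, or that $s=0$ and they have disjoint angular supports, i.e. $y_1y_2<0$ for all $y_1\in\operatorname{supp}\widehat{f_1}$ and $y_2\in\operatorname{supp}\widehat{f_2}$. Then $$\left\|e^{it\phi_s(\sqrt{-\Delta})}f_1\,e^{it\phi_s(\sqrt{-\Delta})}f_2\right\|_{L^2(\mathbb R^{1+1})}^2= \frac{\mathbf{KG}(1)}{2}\int_{\mathbb R^{2}}|\widehat{f_1}(y_1)|^2|\widehat{f_2}(y_2)|^2\phi_s(|y_1|)\phi_s(|y_2|)K_s(y_1,y_2)\,dy_1\,dy_2 .$$ -/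

import Mathlib

open MeasureTheory SchwartzMap
open scoped ENNReal

noncomputable section

namespace KleinGordon

/-- Euclidean space of dimension `d`, with its Euclidean norm and Lebesgue measure. -/
abbrev Space (d : ℕ) : Type := EuclideanSpace ℝ (Fin d)

/-- The spatial Fourier transform `ĥ(ξ) = ∫ h(x) e^{-i x·ξ} dx`. -/
def fourierHat {d : ℕ} (h : Space d → ℂ) (ξ : Space d) : ℂ :=
  ∫ x, h x * Complex.exp (-(Complex.I * ((inner ℝ x ξ : ℝ) : ℂ)))

/-- `g` is the Fourier transform of the function `f` in the sense of tempered distributions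
(for the normalisation of `fourierHat`): both are tempered, i.e. integrable against every
Schwartz function, and `∫ f ψ̂ = ∫ g ψ` for every Schwartz function `ψ`. -/
def HasFourierTransform {d : ℕ} (f g : Space d → ℂ) : Prop :=
  ∀ ψ : 𝓢(Space d, ℂ),
    Integrable (fun x => f x * fourierHat (fun y => ψ y) x) ∧
    Integrable (fun ξ => g ξ * ψ ξ) ∧
    ∫ x, f x * fourierHat (fun y => ψ y) x = ∫ ξ, g ξ * ψ ξ

/-- Membership in the sum space `L¹ + L²`. -/
def MemL1AddL2 {d : ℕ} (g : Space d → ℂ) : Prop :=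
  ∃ g₁ g₂ : Space d → ℂ, MemLp g₁ 1 volume ∧ MemLp g₂ 2 volume ∧ g = g₁ + g₂

/-- `φ_s(r) = √(s² + r²)`. -/
def phi (s r : ℝ) : ℝ := Real.sqrt (s ^ 2 + r ^ 2)

/-- `u = e^{it φ_s(√-Δ)} f`, where `f` has the Fourier transform `fhat` in `L¹ + L²`: `u` is a
measurable function of `(t, x)`, and for every time `t` the function `u(t, ·)` has the
Fourier transform `ξ ↦ e^{it φ_s(|ξ|)} fhat(ξ)`.  This determines `u(t, ·)` up to null sets;
for integrable `fhat` it is `(2π)^{-d} ∫ fhat(ξ) e^{i x·ξ + it φ_s(|ξ|)} dξ`. -/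
structure IsPropagation {d : ℕ} (s : ℝ) (f fhat : Space d → ℂ) (u : ℝ × Space d → ℂ) :
    Prop where
  memL1AddL2 : MemL1AddL2 fhat
  hasFourierTransform : HasFourierTransform f fhat
  measurable : AEStronglyMeasurable u volume
  evolution : ∀ t : ℝ, HasFourierTransform (fun x => u (t, x))
    (fun ξ => Complex.exp (Complex.I * ((t * phi s ‖ξ‖ : ℝ) : ℂ)) * fhat ξ)

/-- The squared `L²(ℝ^{d+1})` norm of the product `u₁ u₂`, with values in `[0, ∞]`. -/
def productNormSq {d : ℕ} (u₁ u₂ : ℝ × Space d → ℂ) : ℝ≥0∞ :=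
  eLpNorm (fun z => u₁ z * u₂ z) 2 volume ^ 2

/-- The kernel `K_s(y₁, y₂)`.  The conventions `x / 0 = 0` and `0 ^ (-1/2) = 0` intervene only
when `φ_s(|y₁|) φ_s(|y₂|) - y₁·y₂ = s²`, i.e. `y₁ = y₂` if `s > 0`, and `y₁`, `y₂` on a common
closed ray from the origin if `s = 0`. -/
def kernel {d : ℕ} (s : ℝ) (y₁ y₂ : Space d) : ℝ :=
  (phi s ‖y₁‖ * phi s ‖y₂‖ - inner ℝ y₁ y₂ - s ^ 2) ^ (((d : ℝ) - 2) / 2) /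
    (phi s ‖y₁‖ * phi s ‖y₂‖ - inner ℝ y₁ y₂ + s ^ 2) ^ ((1 : ℝ) / 2)

/-- The integral over `ℝ^{2d}` of `|f̂₁(y₁)|² |f̂₂(y₂)|² φ_s(|y₁|) φ_s(|y₂|) K_s(y₁, y₂)`,
with values in `[0, ∞]`. -/
def weightedIntegral {d : ℕ} (s : ℝ) (fhat₁ fhat₂ : Space d → ℂ) : ℝ≥0∞ :=
  ∫⁻ y : Space d × Space d, ENNReal.ofReal
    (‖fhat₁ y.1‖ ^ 2 * ‖fhat₂ y.2‖ ^ 2 * phi s ‖y.1‖ * phi s ‖y.2‖ * kernel s y.1 y.2)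

/-- The surface measure `|𝕊^{d-1}|` of the unit sphere (equal to `2` for `d = 1`). -/
def sphereArea (d : ℕ) : ℝ := (volume : Measure (Space d)).toSphere.real Set.univ

/-- `KG(d) = 2^{-(d-1)/2} |𝕊^{d-1}| / (2π)^{3d-1}`. -/
def KG (d : ℕ) : ℝ :=
  (2 : ℝ) ^ (-(((d : ℝ) - 1) / 2)) * sphereArea d / (2 * Real.pi) ^ (3 * (d : ℝ) - 1)

/-- The Fourier transform `e^{-a φ_s(|ξ|)} / φ_s(|ξ|)` of the extremisers. -/
def extremiserHat {d : ℕ} (s a : ℝ) (ξ : Space d) : ℂ :=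
  ((Real.exp (-(a * phi s ‖ξ‖)) / phi s ‖ξ‖ : ℝ) : ℂ)

end KleinGordon

end

/-! The product `u₁ u₂` superposes plane waves whose space-time frequencies are the sums `(φ_s(|y₁|)
+ φ_s(|y₂|), y₁ + y₂)`. Hence its space-time Fourier transform is, up to powers of 2π, the image of
`f̂₁ ⊗ f̂₂` under `energyMomentum` (`IsPropagation.integral_mul_test`), and Plancherel on ℝ^{d+1}
turns the claim into one about the L² norm of that image.

The decisive fact is `map_pairMeasure`: the measure `dy₁ dy₂ / (φ_s φ_s K_s)` is carried by
`energyMomentum` to `pushConst d` times Lebesgue measure on `massCone`. For a fixed total momentum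
ξ, a Lorentz boost from the centre of mass frame parametrises the pairs by a momentum w ≠ 0.
Jacobian times density depends on w only through |w| (`abs_det_mul_invWeight`), so polar coordinates
and the substitution of the total energy τ for |w| leave a multiple of dτ.

The inequality is then Cauchy–Schwarz with weight `φ_s φ_s K_s` against test functions of the
energy-momentum vector (`IsPropagation.productNormSq_le`). Nothing is lost when `f̂₁ ⊗ f̂₂` is the
inverse weight times a function of that vector (`IsPropagation.productNormSq_eq_of_fiberwise`). This
is so for `e^{-aφ_s}/φ_s`: the exponentials multiply to a function of the total energy, and `K_s`
itself depends on energy and momentum only. Where both sides are finite and non-zero, this equality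
makes the constant sharp.

On the line a fibre of `energyMomentum` consists of a pair and its swap. Symmetrising `f̂₁ ⊗ f̂₂`
makes it a function on the fibres, disjointness of the supports removes the cross term, and the
factor 1/2 results.

Data in L¹ + L² are reached by truncating the L² part. Norms are computed by duality with values in
[0, ∞], so that no finiteness is presupposed. -/

namespace KleinGordon

/-! ### Squared L² norms and Cauchy–Schwarz with values in [0, ∞]. -/

section Lp

variable {α : Type*} [MeasurableSpace α] {μ : Measure α}

lemma eLpNorm_two_sq (F : α → ℂ) : eLpNorm F 2 μ ^ 2 = ∫⁻ x, ‖F x‖ₑ ^ 2 ∂μ := by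
  rw [eLpNorm_eq_lintegral_rpow_enorm_toReal two_ne_zero ENNReal.ofNat_ne_top]
  simp only [ENNReal.toReal_ofNat, ENNReal.rpow_ofNat]
  rw [← ENNReal.rpow_natCast, ← ENNReal.rpow_mul]
  norm_num

lemma sq_lintegral_mul_le {f g : α → ℝ≥0∞} (hf : AEMeasurable f μ) (hg : AEMeasurable g μ) :
    (∫⁻ x, f x * g x ∂μ) ^ 2 ≤ (∫⁻ x, f x ^ 2 ∂μ) * ∫⁻ x, g x ^ 2 ∂μ := by
  have h := ENNReal.lintegral_mul_le_Lp_mul_Lq μ Real.HolderConjugate.two_two hf hg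
  simp only [Pi.mul_apply, ENNReal.rpow_ofNat] at h
  refine (pow_le_pow_left' h 2).trans_eq ?_
  rw [mul_pow, ← ENNReal.rpow_natCast, ← ENNReal.rpow_natCast, ← ENNReal.rpow_mul,
    ← ENNReal.rpow_mul]
  norm_num

lemma sq_enorm_integral_mul_le {f g : α → ℂ} (hf : AEStronglyMeasurable f μ)
    (hg : AEStronglyMeasurable g μ) :
    ‖∫ x, f x * g x ∂μ‖ₑ ^ 2 ≤ (∫⁻ x, ‖f x‖ₑ ^ 2 ∂μ) * ∫⁻ x, ‖g x‖ₑ ^ 2 ∂μ := by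
  refine (pow_le_pow_left' (enorm_integral_le_lintegral_enorm _) 2).trans ?_
  simp only [enorm_mul]
  exact sq_lintegral_mul_le hf.enorm hg.enorm

end Lp

/-! ### Functions integrable against Schwartz functions, and L² duality for them. -/

section Tempered

variable {V : Type*} [NormedAddCommGroup V] [InnerProductSpace ℝ V] [FiniteDimensional ℝ V]
  [MeasurableSpace V] [BorelSpace V]

/-- A function which is integrable against every Schwartz function. -/
def Tempered (F : V → ℂ) : Prop := ∀ χ : 𝓢(V, ℂ), Integrable (fun x => F x * χ x)

omit [FiniteDimensional ℝ V] [MeasurableSpace V] [BorelSpace V] in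
lemma exists_schwartz_ofReal {g : V → ℝ} (hg : ContDiff ℝ (↑(⊤ : ℕ∞)) g)
    (hc : HasCompactSupport g) : ∃ χ : 𝓢(V, ℂ), ∀ x, χ x = (g x : ℂ) := by
  have h1 : ContDiff ℝ (↑(⊤ : ℕ∞)) (fun x => (g x : ℂ)) := Complex.ofRealCLM.contDiff.comp hg
  have h2 : HasCompactSupport (fun x => (g x : ℂ)) := hc.comp_left (g := fun r : ℝ => (r : ℂ)) rfl
  exact ⟨h2.toSchwartzMap h1, fun x => rfl⟩

lemma Tempered.locallyIntegrable {F : V → ℂ} (hF : Tempered F) : LocallyIntegrable F := by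
  intro x
  let b : ContDiffBump x := ⟨1, 2, one_pos, one_lt_two⟩
  obtain ⟨χ, hχ⟩ := exists_schwartz_ofReal (b.contDiff (n := ⊤)) b.hasCompactSupport
  refine ⟨Metric.ball x 1, Metric.ball_mem_nhds x one_pos, ?_⟩
  refine ((hF χ).integrableOn (s := Metric.ball x 1)).congr_fun ?_ measurableSet_ball
  intro y hy
  have : b y = 1 := b.one_of_mem_closedBall (Metric.ball_subset_closedBall hy)
  simp [hχ, this]

lemma Tempered.ae_eq {F G : V → ℂ} (hF : Tempered F) (hG : Tempered G)
    (h : ∀ χ : 𝓢(V, ℂ), ∫ x, F x * χ x = ∫ x, G x * χ x) : F =ᵐ[volume] G := by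
  refine ae_eq_of_integral_contDiff_smul_eq hF.locallyIntegrable hG.locallyIntegrable ?_
  intro g hg hc
  obtain ⟨χ, hχ⟩ := exists_schwartz_ofReal hg hc
  simpa [hχ, mul_comm] using h χ

lemma Tempered.of_memLp_two {F : V → ℂ} (hF : MemLp F 2) : Tempered F :=
  fun χ => hF.integrable_mul (χ.memLp 2 volume)

lemma Tempered.of_integrable {F : V → ℂ} (hF : Integrable F) : Tempered F := by
  intro χ
  refine hF.mul_bdd (c := SchwartzMap.seminorm ℝ 0 0 χ) χ.continuous.aestronglyMeasurable ?_
  exact Filter.Eventually.of_forall fun x => χ.norm_le_seminorm ℝ x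

/-- Converse of Cauchy–Schwarz, without assuming that F is in L². The bound lets the pairing with F
extend from the dense Schwartz functions to a functional on L²; its Riesz representative agrees with
the conjugate of F almost everywhere, because both give the same integrals against test functions.
-/
lemma Tempered.lintegral_sq_le {F : V → ℂ} (hF : Tempered F) (A : ℝ≥0∞)
    (h : ∀ χ : 𝓢(V, ℂ), ‖∫ x, F x * χ x‖ₑ ^ 2 ≤ A * ∫⁻ x, ‖χ x‖ₑ ^ 2) :
    ∫⁻ x, ‖F x‖ₑ ^ 2 ≤ A := by
  rcases eq_or_ne A ⊤ with rfl | hA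
  · exact le_top
  let T : 𝓢(V, ℂ) →ₗ[ℂ] ℂ :=
    { toFun := fun χ => ∫ x, F x * χ x
      map_add' := fun χ χ' => by
        simp only [_root_.add_apply, mul_add]
        exact integral_add (hF χ) (hF χ')
      map_smul' := fun c χ => by
        simp only [_root_.smul_apply, smul_eq_mul, RingHom.id_apply]
        rw [← integral_const_mul]
        congr 1; ext x; ring }
  let e : 𝓢(V, ℂ) →ₗ[ℂ] Lp ℂ 2 (volume : Measure V) :=
    (SchwartzMap.toLpCLM ℂ ℂ 2 volume).toLinearMap
  have he : DenseRange e := SchwartzMap.denseRange_toLpCLM (E := V) (F := ℂ) (by simp)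
  have hT : ∀ χ, ‖T χ‖ ≤ √A.toReal * ‖e χ‖ := by
    intro χ
    have h1 := h χ
    rw [← eLpNorm_two_sq] at h1
    have h2 : ‖e χ‖ = (eLpNorm χ 2 volume).toReal := by
      change ‖χ.toLp 2 volume‖ = _
      rw [SchwartzMap.toLp, Lp.norm_toLp]
    have h3 : eLpNorm χ 2 volume ≠ ⊤ := (χ.memLp 2 volume).2.ne
    rw [h2]
    refine le_of_sq_le_sq ?_ (by positivity)
    rw [mul_pow, Real.sq_sqrt ENNReal.toReal_nonneg]
    have := ENNReal.toReal_mono (ENNReal.mul_ne_top hA (by finiteness)) h1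
    simpa [T] using this
  let L := T.extendOfNorm e
  have hL : ∀ χ, L (e χ) = T χ := T.extendOfNorm_eq he ⟨_, hT⟩
  have hLn : ∀ x, ‖L x‖ ≤ √A.toReal * ‖x‖ := T.norm_extendOfNorm_apply_le he _ hT
  let g := (InnerProductSpace.toDual ℂ _).symm L
  have hg : ‖g‖ ≤ √A.toReal := by
    rw [LinearIsometryEquiv.norm_map]
    exact L.opNorm_le_bound (by positivity) hLn
  have hgm : MemLp (g : V → ℂ) 2 volume := Lp.memLp g
  have hgs : MemLp (fun x => star (g x)) 2 volume := hgm.star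
  -- The conjugate appears because the inner product is conjugate linear in its first argument.
  have hFg : F =ᵐ[volume] fun x => star (g x) := by
    refine hF.ae_eq (.of_memLp_two hgs) fun χ => ?_
    have h1 : T χ = inner ℂ g (e χ) := by
      rw [InnerProductSpace.toDual_symm_apply, hL]
    rw [L2.inner_def] at h1
    refine h1.trans (integral_congr_ae ?_)
    filter_upwards [χ.coeFn_toLp 2 volume] with x hx
    have : (e χ : V → ℂ) x = χ x := hx
    rw [this]
    simp [mul_comm]
  have h5 : ∫⁻ x, ‖F x‖ₑ ^ 2 = ∫⁻ x, ‖g x‖ₑ ^ 2 := by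
    refine lintegral_congr_ae ?_
    filter_upwards [hFg] with x hx
    rw [hx]
    simp [enorm_eq_nnnorm]
  rw [h5, ← eLpNorm_two_sq]
  have h6 : (eLpNorm g 2 volume).toReal ^ 2 ≤ A.toReal := by
    rw [← Lp.norm_def]
    calc ‖g‖ ^ 2 ≤ (√A.toReal) ^ 2 := by gcongr
      _ = A.toReal := Real.sq_sqrt ENNReal.toReal_nonneg
  rw [← ENNReal.toReal_pow] at h6
  exact (ENNReal.toReal_le_toReal (by finiteness [hgm.2.ne]) hA).1 h6

end Tempered

/-! ### Plancherel's theorem for tempered functions. -/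

section Fourier

open scoped FourierTransform

variable {V : Type*} [NormedAddCommGroup V] [InnerProductSpace ℝ V] [FiniteDimensional ℝ V]
  [MeasurableSpace V] [BorelSpace V]

/-- The conjugate Fourier transform `∫ χ(x) e^{i x·ξ} dx`. -/
noncomputable def conjFourier (χ : V → ℂ) (ξ : V) : ℂ :=
  ∫ x, χ x * Complex.exp (Complex.I * ((inner ℝ x ξ : ℝ) : ℂ))

/-- Dilation by `r ≠ 0` as a continuous linear equivalence. -/
noncomputable def dilation (V : Type*) [NormedAddCommGroup V] [NormedSpace ℝ V] (r : ℝ) (hr : r ≠ 0) :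
    V ≃L[ℝ] V := ContinuousLinearEquiv.smulLeft (Units.mk0 r hr)

/-- The phase of `𝓕⁻` carries a factor 2π; a dilation of the frequency absorbs it. -/
lemma conjFourier_eq_fourierInv (χ : V → ℂ) (ξ : V) :
    conjFourier χ ξ = 𝓕⁻ χ ((2 * Real.pi)⁻¹ • ξ) := by
  rw [Real.fourierInv_eq', conjFourier]
  congr 1; ext x
  rw [inner_smul_right, ← mul_assoc, mul_inv_cancel₀ (by positivity), one_mul, smul_eq_mul,
    mul_comm, mul_comm Complex.I]

lemma exists_schwartz_conjFourier (χ : 𝓢(V, ℂ)) :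
    ∃ X : 𝓢(V, ℂ), ∀ ξ, X ξ = conjFourier χ ξ := by
  have h : (2 * Real.pi)⁻¹ ≠ 0 := by positivity
  refine ⟨SchwartzMap.compCLMOfContinuousLinearEquiv ℂ (dilation V _ h) (𝓕⁻ χ), fun ξ => ?_⟩
  rw [conjFourier_eq_fourierInv, ← SchwartzMap.fourierInv_coe]
  rfl

lemma exists_conjFourier_eq (X : 𝓢(V, ℂ)) :
    ∃ χ : 𝓢(V, ℂ), ∀ ξ, X ξ = conjFourier χ ξ := by
  have h : 2 * Real.pi ≠ 0 := by positivity
  refine ⟨𝓕 (SchwartzMap.compCLMOfContinuousLinearEquiv ℂ (dilation V _ h) X), fun ξ => ?_⟩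
  rw [conjFourier_eq_fourierInv, ← SchwartzMap.fourierInv_coe, FourierTransform.fourierInv_fourier_eq]
  change X ξ = X ((2 * Real.pi) • (2 * Real.pi)⁻¹ • ξ)
  rw [smul_smul, mul_inv_cancel₀ h, one_smul]

/-- Plancherel's theorem for the conjugate Fourier transform of Schwartz functions. -/
lemma lintegral_sq_conjFourier (χ : 𝓢(V, ℂ)) :
    ∫⁻ ξ, ‖conjFourier χ ξ‖ₑ ^ 2 =
      ENNReal.ofReal ((2 * Real.pi) ^ Module.finrank ℝ V) * ∫⁻ x, ‖χ x‖ₑ ^ 2 := by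
  have key (f : 𝓢(V, ℂ)) : ∫⁻ x, ‖f x‖ₑ ^ 2 = ENNReal.ofReal (∫ x, ‖f x‖ ^ 2) := by
    rw [ofReal_integral_eq_lintegral_ofReal]
    · congr 1; ext x
      rw [ENNReal.ofReal_pow (norm_nonneg _), ofReal_norm]
    · exact (memLp_two_iff_integrable_sq_norm f.continuous.aestronglyMeasurable).1 (f.memLp 2 volume)
    · exact Filter.Eventually.of_forall fun x => by positivity
  obtain ⟨X, hX⟩ := exists_schwartz_conjFourier χ
  simp_rw [← hX]
  rw [key, key, ← ENNReal.ofReal_mul (by positivity)]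
  congr 1
  simp_rw [hX, conjFourier_eq_fourierInv]
  rw [Measure.integral_comp_smul volume (fun ξ => ‖𝓕⁻ (χ : V → ℂ) ξ‖ ^ 2) (2 * Real.pi)⁻¹]
  have h := SchwartzMap.integral_norm_sq_fourier (𝓕⁻ χ)
  rw [FourierTransform.fourier_fourierInv_eq, SchwartzMap.fourierInv_coe] at h
  rw [h, smul_eq_mul]
  congr 1
  rw [inv_pow, inv_inv, abs_of_pos (by positivity)]

/-- Plancherel's theorem for tempered functions, with values in `[0, ∞]`. -/
lemma lintegral_sq_eq_of_conjFourier {F H : V → ℂ} (hF : Tempered F) (hH : Tempered H) (c : ℝ)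
    (hc : 0 < c)
    (h : ∀ χ : 𝓢(V, ℂ), ∫ x, F x * χ x = c * ∫ ξ, H ξ * conjFourier χ ξ) :
    ∫⁻ x, ‖F x‖ₑ ^ 2 =
      ENNReal.ofReal (c ^ 2 * (2 * Real.pi) ^ Module.finrank ℝ V) * ∫⁻ ξ, ‖H ξ‖ₑ ^ 2 := by
  set n := Module.finrank ℝ V
  have hcn : ‖(c : ℂ)‖ₑ ^ 2 = ENNReal.ofReal (c ^ 2) := by
    rw [← ofReal_norm, ← ENNReal.ofReal_pow (norm_nonneg _)]
    simp
  have hFm := hF.locallyIntegrable.aestronglyMeasurable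
  have hHm := hH.locallyIntegrable.aestronglyMeasurable
  apply le_antisymm
  -- Duality for F: Cauchy–Schwarz on the H side and Plancherel for the test function.
  · refine hF.lintegral_sq_le _ fun χ => ?_
    obtain ⟨X, hX⟩ := exists_schwartz_conjFourier χ
    rw [h, enorm_mul, mul_pow, hcn]
    simp_rw [← hX]
    refine (mul_le_mul_right (sq_enorm_integral_mul_le hHm
      X.continuous.aestronglyMeasurable) _).trans_eq ?_
    simp_rw [hX]
    rw [lintegral_sq_conjFourier, ENNReal.ofReal_mul (by positivity)]
    ring
  · have hne : ENNReal.ofReal (c ^ 2 * (2 * Real.pi) ^ n) ≠ 0 := by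
      rw [Ne, ENNReal.ofReal_eq_zero, not_le]; positivity
    rw [ENNReal.mul_le_iff_le_inv hne ENNReal.ofReal_ne_top]
    -- Duality for H: every Schwartz function is the `conjFourier` of another one, so the roles of F
    -- and H can be exchanged.
    refine hH.lintegral_sq_le _ fun X => ?_
    obtain ⟨χ, hχ⟩ := exists_conjFourier_eq X
    rw [mul_assoc, ← ENNReal.mul_le_iff_le_inv hne ENNReal.ofReal_ne_top]
    have h1 := sq_enorm_integral_mul_le hFm (χ.continuous.aestronglyMeasurable (μ := volume))
    rw [h, enorm_mul, mul_pow, hcn] at h1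
    simp_rw [hχ]
    rw [lintegral_sq_conjFourier, ENNReal.ofReal_mul (by positivity)]
    calc _ = ENNReal.ofReal ((2 * Real.pi) ^ n) * (ENNReal.ofReal (c ^ 2) *
          ‖∫ ξ, H ξ * conjFourier χ ξ‖ₑ ^ 2) := by ring
      _ ≤ _ := mul_le_mul_right h1 _
      _ = _ := by ring

end Fourier
-- Decay of Schwartz functions.
section Decay

variable {V : Type*} [NormedAddCommGroup V] [InnerProductSpace ℝ V]

lemma schwartz_decay (χ : 𝓢(V, ℂ)) (k : ℕ) :
    ∃ C : ℝ, 0 ≤ C ∧ ∀ v, (1 + ‖v‖) ^ k * ‖χ v‖ ≤ C := by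
  refine ⟨2 ^ k * ((Finset.Iic (k, 0)).sup fun m => SchwartzMap.seminorm ℝ m.1 m.2) χ,
    by positivity, fun v => ?_⟩
  simpa using SchwartzMap.one_add_le_sup_seminorm_apply (𝕜 := ℝ) (m := (k, 0)) le_rfl le_rfl χ v

end Decay

/-! ### The propagation at a fixed time. -/

section Slices

open scoped FourierTransform

variable {d : ℕ}

lemma fourierHat_eq_fourier (ψ : Space d → ℂ) (ξ : Space d) :
    fourierHat ψ ξ = 𝓕 ψ ((2 * Real.pi)⁻¹ • ξ) := by
  rw [Real.fourier_eq', fourierHat]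
  congr 1; ext x
  rw [inner_smul_right, neg_mul, neg_mul, ← mul_assoc, mul_inv_cancel₀ (by positivity), one_mul,
    smul_eq_mul, mul_comm, mul_comm Complex.I]
  push_cast
  ring_nf

lemma exists_schwartz_fourierHat (ψ : 𝓢(Space d, ℂ)) :
    ∃ χ : 𝓢(Space d, ℂ), ∀ ξ, χ ξ = fourierHat ψ ξ := by
  have h : (2 * Real.pi)⁻¹ ≠ 0 := by positivity
  refine ⟨SchwartzMap.compCLMOfContinuousLinearEquiv ℂ (dilation _ _ h) (𝓕 ψ), fun ξ => ?_⟩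
  rw [fourierHat_eq_fourier, ← SchwartzMap.fourier_coe]
  rfl

lemma exists_fourierHat_eq (χ : 𝓢(Space d, ℂ)) :
    ∃ ψ : 𝓢(Space d, ℂ), ∀ ξ, χ ξ = fourierHat ψ ξ := by
  have h : 2 * Real.pi ≠ 0 := by positivity
  refine ⟨𝓕⁻ (SchwartzMap.compCLMOfContinuousLinearEquiv ℂ (dilation _ _ h) χ), fun ξ => ?_⟩
  rw [fourierHat_eq_fourier, ← SchwartzMap.fourier_coe, FourierTransform.fourier_fourierInv_eq]
  change χ ξ = χ ((2 * Real.pi) • (2 * Real.pi)⁻¹ • ξ)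
  rw [smul_smul, mul_inv_cancel₀ h, one_smul]

lemma conjFourier_fourierHat (ψ : 𝓢(Space d, ℂ)) (ξ : Space d) :
    conjFourier (fourierHat ψ) ξ = (2 * Real.pi) ^ d * ψ ξ := by
  let F : Space d → ℂ := fun v => 𝓕 (ψ : Space d → ℂ) v *
    Complex.exp (Complex.I * ((2 * Real.pi * inner ℝ v ξ : ℝ) : ℂ))
  have h1 : conjFourier (fourierHat ψ) ξ = ∫ x : Space d, F ((2 * Real.pi)⁻¹ • x) := by
    rw [conjFourier]
    congr 1; ext x
    simp only [fourierHat_eq_fourier, inner_smul_left, F]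
    congr 4
    simp only [map_inv₀, conj_trivial]
    field_simp
  rw [h1, Measure.integral_comp_smul volume F]
  have h2 : (𝓕⁻ (𝓕 ψ) : 𝓢(Space d, ℂ)) ξ = ψ ξ := by rw [FourierTransform.fourierInv_fourier_eq]
  rw [SchwartzMap.fourierInv_coe, SchwartzMap.fourier_coe, Real.fourierInv_eq'] at h2
  rw [← h2]
  rw [inv_pow, inv_inv, abs_of_pos (by positivity), finrank_euclideanSpace_fin]
  simp only [smul_eq_mul, Complex.real_smul]
  push_cast
  congr 1
  congr 1; ext v
  simp only [F]
  push_cast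
  ring_nf

/-- Fourier inversion on the test function: since `fourierHat` is onto the Schwartz functions, the
definition takes the form required by `lintegral_sq_eq_of_conjFourier`, with c = (2π)^{-d}. -/
lemma hasFourierTransform_iff {f g : Space d → ℂ} :
    HasFourierTransform f g ↔ Tempered f ∧ Tempered g ∧ ∀ χ : 𝓢(Space d, ℂ),
      ∫ x, f x * χ x = ((((2 * Real.pi) ^ d)⁻¹ : ℝ) : ℂ) * ∫ ξ, g ξ * conjFourier χ ξ := by
  have hpi : ((2 * Real.pi) ^ d : ℂ) ≠ 0 := by
    exact_mod_cast (by positivity : (2 * Real.pi) ^ d ≠ 0)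
  constructor
  · intro h
    refine ⟨fun χ => ?_, fun ψ => (h ψ).2.1, fun χ => ?_⟩
    · obtain ⟨ψ, hψ⟩ := exists_fourierHat_eq χ
      simpa [hψ] using (h ψ).1
    · obtain ⟨ψ, hψ⟩ := exists_fourierHat_eq χ
      have : (χ : Space d → ℂ) = fourierHat ψ := funext hψ
      rw [this, (h ψ).2.2]
      simp_rw [conjFourier_fourierHat]
      rw [← integral_const_mul]
      congr 1; ext ξ
      push_cast
      field_simp
  · rintro ⟨hf, hg, h⟩ ψ
    obtain ⟨χ, hχ⟩ := exists_schwartz_fourierHat ψ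
    have hc : (χ : Space d → ℂ) = fourierHat ψ := funext hχ
    have h1 := hf χ
    have h2 := h χ
    rw [hc] at h1 h2
    refine ⟨h1, hg ψ, h2.trans ?_⟩
    simp_rw [conjFourier_fourierHat]
    rw [← integral_const_mul]
    congr 1; ext ξ
    push_cast
    field_simp

lemma HasFourierTransform.sub {f g f' g' : Space d → ℂ} (h : HasFourierTransform f g)
    (h' : HasFourierTransform f' g') :
    HasFourierTransform (fun x => f x - f' x) (fun x => g x - g' x) := by
  intro ψ
  obtain ⟨h1, h2, h3⟩ := h ψ
  obtain ⟨h1', h2', h3'⟩ := h' ψ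
  simp only [sub_mul]
  exact ⟨h1.sub h1', h2.sub h2', by rw [integral_sub h1 h1', integral_sub h2 h2', h3, h3']⟩

lemma HasFourierTransform.lintegral_sq_eq {f g : Space d → ℂ} (h : HasFourierTransform f g) :
    ∫⁻ x, ‖f x‖ₑ ^ 2 = ENNReal.ofReal ((2 * Real.pi) ^ d)⁻¹ * ∫⁻ ξ, ‖g ξ‖ₑ ^ 2 := by
  rw [hasFourierTransform_iff] at h
  obtain ⟨hf, hg, h⟩ := h
  rw [lintegral_sq_eq_of_conjFourier hf hg _ (by positivity) h, finrank_euclideanSpace_fin]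
  congr 2
  field_simp

/-- The propagation `(2π)^{-d} ∫ g(ξ) e^{i x·ξ + it φ_s(|ξ|)} dξ` of integrable data. -/
noncomputable def wave (s : ℝ) (g : Space d → ℂ) (z : ℝ × Space d) : ℂ :=
  ((((2 * Real.pi) ^ d)⁻¹ : ℝ) : ℂ) *
    conjFourier (fun ξ => Complex.exp (Complex.I * ((z.1 * phi s ‖ξ‖ : ℝ) : ℂ)) * g ξ) z.2

lemma norm_exp_I_mul (r : ℝ) : ‖Complex.exp (Complex.I * (r : ℂ))‖ = 1 := by
  rw [mul_comm]; exact Complex.norm_exp_ofReal_mul_I r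

lemma continuous_phi (s : ℝ) : Continuous (phi s) := by
  unfold phi; fun_prop

lemma integrable_phase_mul {s t : ℝ} {g : Space d → ℂ} (hg : Integrable g) :
    Integrable (fun ξ => Complex.exp (Complex.I * ((t * phi s ‖ξ‖ : ℝ) : ℂ)) * g ξ) := by
  have := continuous_phi s
  refine hg.bdd_mul (c := 1) (by fun_prop) ?_
  exact Filter.Eventually.of_forall fun x => (norm_exp_I_mul _).le

lemma continuous_wave (s : ℝ) {g : Space d → ℂ} (hg : Integrable g) : Continuous (wave s g) := by
  have := continuous_phi s
  unfold wave conjFourier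
  refine continuous_const.mul (continuous_of_dominated (bound := fun ξ => ‖g ξ‖) ?_ ?_ hg.norm ?_)
  · intro z
    exact (integrable_phase_mul hg).aestronglyMeasurable.mul (by fun_prop)
  · intro z
    refine Filter.Eventually.of_forall fun ξ => ?_
    rw [norm_mul, norm_mul, norm_exp_I_mul, norm_exp_I_mul, one_mul, mul_one]
  · exact Filter.Eventually.of_forall fun ξ => by fun_prop

lemma norm_wave_le (s : ℝ) (g : Space d → ℂ) (z : ℝ × Space d) :
    ‖wave s g z‖ ≤ ((2 * Real.pi) ^ d)⁻¹ * ∫ ξ, ‖g ξ‖ := by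
  rw [wave, norm_mul, Complex.norm_real, Real.norm_of_nonneg (by positivity)]
  gcongr
  refine (norm_integral_le_integral_norm _).trans_eq ?_
  congr 1; ext ξ
  rw [norm_mul, norm_mul, norm_exp_I_mul, norm_exp_I_mul, one_mul, mul_one]

lemma hasFourierTransform_wave (s : ℝ) {g : Space d → ℂ} (hg : Integrable g) (t : ℝ) :
    HasFourierTransform (fun x => wave s g (t, x))
      (fun ξ => Complex.exp (Complex.I * ((t * phi s ‖ξ‖ : ℝ) : ℂ)) * g ξ) := by
  have hg' := integrable_phase_mul (s := s) (t := t) hg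
  rw [hasFourierTransform_iff]
  refine ⟨fun χ => ?_, .of_integrable hg', fun χ => ?_⟩
  · refine χ.integrable.bdd_mul (c := ((2 * Real.pi) ^ d)⁻¹ * ∫ ξ, ‖g ξ‖) ?_ ?_
    · exact ((continuous_wave s hg).comp (by fun_prop : Continuous fun x => (t, x))).aestronglyMeasurable
    · exact Filter.Eventually.of_forall fun x => norm_wave_le s g _
  · simp only [wave, mul_assoc]
    rw [integral_const_mul]
    congr 1
    simp only [conjFourier, ← integral_mul_const, ← integral_const_mul]
    rw [integral_integral_swap]
    · congr 1; ext ξ; congr 1; ext x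
      rw [real_inner_comm]; ring
    · have h1 : Integrable (fun p : Space d × Space d => χ p.1 *
          (Complex.exp (Complex.I * ((t * phi s ‖p.2‖ : ℝ) : ℂ)) * g p.2)) :=
        χ.integrable.mul_prod hg'
      have h2 := h1.bdd_mul (c := 1)
        (f := fun p => Complex.exp (Complex.I * ((inner ℝ p.2 p.1 : ℝ) : ℂ)))
        (by fun_prop) (Filter.Eventually.of_forall fun x => (norm_exp_I_mul _).le)
      refine h2.congr (Filter.Eventually.of_forall fun p => ?_)
      simp only [Function.uncurry]
      ring

end Slices

/-! ### Products of propagations of integrable data, tested in space-time. -/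

section Pairing

variable {d : ℕ}

/-- Space-time with its Euclidean inner product. -/
abbrev SpaceTime (d : ℕ) : Type := WithLp 2 (ℝ × Space d)

/-- The sum of the energy-momentum vectors `(φ_s(|y₁|), y₁)` and `(φ_s(|y₂|), y₂)`. -/
noncomputable def energyMomentum (s : ℝ) (y : Space d × Space d) : ℝ × Space d :=
  (phi s ‖y.1‖ + phi s ‖y.2‖, y.1 + y.2)

lemma continuous_energyMomentum (s : ℝ) :
    Continuous (energyMomentum s : Space d × Space d → ℝ × Space d) := by
  have := continuous_phi s
  unfold energyMomentum; fun_prop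

lemma le_phi (s : ℝ) (r : ℝ) : r ≤ phi s r :=
  Real.le_sqrt_of_sq_le (by nlinarith [sq_nonneg s])

lemma phi_nonneg (s r : ℝ) : 0 ≤ phi s r := Real.sqrt_nonneg _

lemma integral_spaceTime (F : SpaceTime d → ℂ) :
    ∫ v, F v = ∫ z : ℝ × Space d, F (WithLp.toLp 2 z) :=
  ((WithLp.volume_preserving_toLp ℝ (Space d)).integral_comp
    (MeasurableEquiv.toLp 2 (ℝ × Space d)).measurableEmbedding F).symm

lemma integrable_spaceTime {F : SpaceTime d → ℂ} :
    Integrable F ↔ Integrable (fun z : ℝ × Space d => F (WithLp.toLp 2 z)) :=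
  ((WithLp.volume_preserving_toLp ℝ (Space d)).integrable_comp_emb
    (MeasurableEquiv.toLp 2 (ℝ × Space d)).measurableEmbedding).symm

lemma lintegral_spaceTime (F : SpaceTime d → ℝ≥0∞) :
    ∫⁻ v, F v = ∫⁻ z : ℝ × Space d, F (WithLp.toLp 2 z) :=
  ((WithLp.volume_preserving_toLp ℝ (Space d)).lintegral_comp_emb
    (MeasurableEquiv.toLp 2 (ℝ × Space d)).measurableEmbedding F).symm

lemma conjFourier_spaceTime (χ : SpaceTime d → ℂ) (q : ℝ × Space d) :
    conjFourier χ (WithLp.toLp 2 q) = ∫ z : ℝ × Space d, χ (WithLp.toLp 2 z) *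
      Complex.exp (Complex.I * ((z.1 * q.1 + inner ℝ z.2 q.2 : ℝ) : ℂ)) := by
  rw [conjFourier, integral_spaceTime]
  simp [WithLp.prod_inner_apply, mul_comm]

/-- The plane wave `e^{i x·ξ + it φ_s(|ξ|)}`. -/
noncomputable def planeWave (s : ℝ) (z : ℝ × Space d) (ξ : Space d) : ℂ :=
  Complex.exp (Complex.I * ((z.1 * phi s ‖ξ‖ : ℝ) : ℂ)) *
    Complex.exp (Complex.I * ((inner ℝ ξ z.2 : ℝ) : ℂ))

lemma continuous_planeWave (s : ℝ) :
    Continuous (fun p : (ℝ × Space d) × Space d => planeWave s p.1 p.2) := by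
  have hphi := continuous_phi s
  unfold planeWave; fun_prop

lemma norm_planeWave (s : ℝ) (z : ℝ × Space d) (ξ : Space d) : ‖planeWave s z ξ‖ = 1 := by
  rw [planeWave, norm_mul, norm_exp_I_mul, norm_exp_I_mul, one_mul]

lemma wave_eq_integral_planeWave (s : ℝ) (g : Space d → ℂ) (z : ℝ × Space d) :
    wave s g z = ((((2 * Real.pi) ^ d)⁻¹ : ℝ) : ℂ) * ∫ ξ, g ξ * planeWave s z ξ := by
  rw [wave, conjFourier]
  congr 2; ext ξ; rw [planeWave]; ring

lemma planeWave_mul_planeWave (s : ℝ) (z : ℝ × Space d) (y : Space d × Space d) :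
    planeWave s z y.1 * planeWave s z y.2 = Complex.exp (Complex.I *
      ((z.1 * (energyMomentum s y).1 + inner ℝ z.2 (energyMomentum s y).2 : ℝ) : ℂ)) := by
  simp only [planeWave, energyMomentum]
  rw [inner_add_right, real_inner_comm, real_inner_comm (x := z.2) (y := y.2)]
  push_cast
  simp only [mul_add, Complex.exp_add]
  ring

lemma integrable_prod_planeWave (s : ℝ) {g₁ g₂ : Space d → ℂ} (h₁ : Integrable g₁)
    (h₂ : Integrable g₂) {χ : ℝ × Space d → ℂ} (hχ : Integrable χ) :
    Integrable (fun p : (ℝ × Space d) × (Space d × Space d) =>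
      (g₁ p.2.1 * g₂ p.2.2) * (planeWave s p.1 p.2.1 * planeWave s p.1 p.2.2) * χ p.1) := by
  have hi : Integrable (fun p : (ℝ × Space d) × (Space d × Space d) =>
      χ p.1 * (g₁ p.2.1 * g₂ p.2.2)) := hχ.mul_prod (h₁.mul_prod h₂)
  have hc : Continuous fun p : (ℝ × Space d) × (Space d × Space d) =>
      planeWave s p.1 p.2.1 * planeWave s p.1 p.2.2 :=
    ((continuous_planeWave s).comp (by fun_prop : Continuous
      fun p : (ℝ × Space d) × (Space d × Space d) => (p.1, p.2.1))).mul
    ((continuous_planeWave s).comp (by fun_prop : Continuous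
      fun p : (ℝ × Space d) × (Space d × Space d) => (p.1, p.2.2)))
  have h2 := hi.bdd_mul (c := 1) hc.aestronglyMeasurable
    (Filter.Eventually.of_forall fun x => by
      rw [norm_mul, norm_planeWave, norm_planeWave, one_mul])
  refine h2.congr (Filter.Eventually.of_forall fun p => ?_)
  ring

/-- Fubini: two plane waves with momenta y₁, y₂ multiply to the plane wave of frequency
`energyMomentum s y`, and integrating the test function against it gives `conjFourier` there. -/
lemma integral_wave_mul_wave (s : ℝ) {g₁ g₂ : Space d → ℂ} (h₁ : Integrable g₁)
    (h₂ : Integrable g₂) (χ : 𝓢(SpaceTime d, ℂ)) :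
    ∫ z : ℝ × Space d, wave s g₁ z * wave s g₂ z * χ (WithLp.toLp 2 z) =
      ((((2 * Real.pi) ^ (2 * d))⁻¹ : ℝ) : ℂ) * ∫ y : Space d × Space d,
        g₁ y.1 * g₂ y.2 * conjFourier χ (WithLp.toLp 2 (energyMomentum s y)) := by
  have h1 (z) : wave s g₁ z * wave s g₂ z * χ (WithLp.toLp 2 z) =
      ((((2 * Real.pi) ^ (2 * d))⁻¹ : ℝ) : ℂ) * ∫ y : Space d × Space d,
        (g₁ y.1 * g₂ y.2) * (planeWave s z y.1 * planeWave s z y.2) * χ (WithLp.toLp 2 z) := by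
    have h2 := integral_prod_mul (μ := (volume : Measure (Space d)))
      (ν := (volume : Measure (Space d))) (fun y => g₁ y * planeWave s z y)
      (fun y => g₂ y * planeWave s z y)
    simp only [mul_mul_mul_comm (g₁ _) (planeWave _ _ _)] at h2
    rw [integral_mul_const, wave_eq_integral_planeWave, wave_eq_integral_planeWave,
      Measure.volume_eq_prod, h2]
    push_cast
    ring
  simp only [h1]
  rw [integral_const_mul]
  congr 1
  rw [integral_integral_swap
    (integrable_prod_planeWave s h₁ h₂ (integrable_spaceTime.1 χ.integrable))]
  congr 1; ext y
  rw [conjFourier_spaceTime, ← integral_const_mul]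
  congr 1; ext z
  rw [planeWave_mul_planeWave]
  ring

lemma integrable_inv_one_add_norm_pow :
    Integrable (fun y : Space d => (((1 + ‖y‖) ^ (d + 1))⁻¹ : ℝ)) := by
  have h := integrable_one_add_norm (E := Space d) (μ := volume) (r := (d : ℝ) + 1)
    (by rw [finrank_euclideanSpace_fin]; linarith)
  refine h.congr (Filter.Eventually.of_forall fun y => ?_)
  simp only
  rw [Real.rpow_neg (by positivity)]
  norm_cast

lemma integrable_mul_inv_one_add_norm_pow_of_memLp {h : Space d → ℂ} (hh : MemLp h 2) :
    Integrable (fun y => ‖h y‖ * ((1 + ‖y‖) ^ (d + 1))⁻¹) := by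
  have h1 : MemLp (fun y : Space d => (((1 + ‖y‖) ^ (d + 1))⁻¹ : ℝ)) 2 := by
    rw [memLp_two_iff_integrable_sq (integrable_inv_one_add_norm_pow).aestronglyMeasurable]
    refine integrable_inv_one_add_norm_pow.mono'
      (by have := (integrable_inv_one_add_norm_pow (d := d)).aestronglyMeasurable; fun_prop) ?_
    refine Filter.Eventually.of_forall fun y => ?_
    rw [Real.norm_of_nonneg (by positivity), sq]
    refine mul_le_of_le_one_left (by positivity) (inv_le_one_of_one_le₀ ?_)
    exact one_le_pow₀ (by linarith [norm_nonneg y])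
  exact hh.norm.integrable_mul h1

lemma integrable_mul_inv_one_add_norm_pow {g : Space d → ℂ} (hg : Integrable g) :
    Integrable (fun y => ‖g y‖ * ((1 + ‖y‖) ^ (d + 1))⁻¹) := by
  refine hg.norm.mul_bdd (c := 1) (integrable_inv_one_add_norm_pow).aestronglyMeasurable ?_
  refine Filter.Eventually.of_forall fun y => ?_
  rw [Real.norm_of_nonneg (by positivity)]
  exact inv_le_one_of_one_le₀ (one_le_pow₀ (by linarith [norm_nonneg y]))

/-- The total energy dominates |y₁| + |y₂|, hence (1 + |y₁|)(1 + |y₂|) ≤ (1 + |v|)², and decay of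
order 2(d+1) in v splits between the two momenta. The weight (1 + |y|)^{-(d+1)} lies in L¹, L² and
L^∞, so the pairing converges for data in L¹ + L². -/
lemma norm_schwartz_energyMomentum_le (s : ℝ) (X : 𝓢(SpaceTime d, ℂ)) :
    ∃ C : ℝ, 0 ≤ C ∧ ∀ y : Space d × Space d, ‖X (WithLp.toLp 2 (energyMomentum s y))‖ ≤
      C * (((1 + ‖y.1‖) ^ (d + 1))⁻¹ * ((1 + ‖y.2‖) ^ (d + 1))⁻¹) := by
  obtain ⟨C, hC, h⟩ := schwartz_decay X (2 * (d + 1))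
  refine ⟨C, hC, fun y => ?_⟩
  have h1 := h (WithLp.toLp 2 (energyMomentum s y))
  set v := WithLp.toLp 2 (energyMomentum s y)
  have h2 : ‖y.1‖ + ‖y.2‖ ≤ ‖v‖ := by
    have h3 : ‖v.fst‖ ≤ ‖v‖ := WithLp.norm_fst_le ℝ v
    have h4 : v.fst = phi s ‖y.1‖ + phi s ‖y.2‖ := rfl
    rw [h4, Real.norm_of_nonneg (add_nonneg (phi_nonneg _ _) (phi_nonneg _ _))] at h3
    linarith [le_phi s ‖y.1‖, le_phi s ‖y.2‖]
  rw [← mul_inv, ← mul_pow, ← div_eq_mul_inv, le_div_iff₀ (by positivity), mul_comm]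
  refine le_trans ?_ h1
  gcongr
  rw [pow_mul]
  gcongr
  nlinarith [norm_nonneg y.1, norm_nonneg y.2, norm_nonneg v]

end Pairing

/-! ### Extension to data in L¹ + L². -/

section General

open Filter Topology

variable {d : ℕ}

/-- Lebesgue measure on space-time, weighted by the modulus of a test function. -/
noncomputable def weighted (χ : 𝓢(SpaceTime d, ℂ)) : Measure (ℝ × Space d) :=
  volume.withDensity fun z => ‖χ (WithLp.toLp 2 z)‖ₑ

lemma continuous_test (χ : 𝓢(SpaceTime d, ℂ)) :
    Continuous fun z : ℝ × Space d => χ (WithLp.toLp 2 z) :=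
  χ.continuous.comp (WithLp.prod_continuous_toLp 2 ℝ (Space d))

lemma lintegral_weighted (χ : 𝓢(SpaceTime d, ℂ)) {F : ℝ × Space d → ℝ≥0∞}
    (hF : AEMeasurable F volume) :
    ∫⁻ z, F z ∂(weighted χ) = ∫⁻ z, ‖χ (WithLp.toLp 2 z)‖ₑ * F z := by
  rw [weighted, lintegral_withDensity_eq_lintegral_mul₀
    (continuous_test χ).enorm.measurable.aemeasurable hF]
  rfl

instance isFiniteMeasure_weighted (χ : 𝓢(SpaceTime d, ℂ)) : IsFiniteMeasure (weighted χ) :=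
  isFiniteMeasure_withDensity (integrable_spaceTime.1 χ.integrable).2.ne

lemma weighted_absolutelyContinuous (χ : 𝓢(SpaceTime d, ℂ)) : weighted χ ≪ volume :=
  withDensity_absolutelyContinuous _ _

/-- A majorant independent of x is needed because Plancherel controls u only on whole time slices.
-/
lemma exists_time_bound (χ : 𝓢(SpaceTime d, ℂ)) :
    ∃ C : ℝ≥0∞, C ≠ ⊤ ∧ ∃ m : ℝ → ℝ≥0∞, Measurable m ∧ ∫⁻ t, m t ≤ C ∧
      ∀ t x, ‖χ (WithLp.toLp 2 (t, x))‖ₑ ≤ m t := by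
  obtain ⟨C, hC, h⟩ := schwartz_decay χ 2
  have hi : Integrable (fun t : ℝ => C * (1 + t ^ 2)⁻¹) := integrable_inv_one_add_sq.const_mul C
  refine ⟨_, hi.2.ne, fun t => ‖C * (1 + t ^ 2)⁻¹‖ₑ, ?_, le_rfl, fun t x => ?_⟩
  · exact (by fun_prop : Measurable fun t : ℝ => C * (1 + t ^ 2)⁻¹).enorm
  · rw [enorm_le_iff_norm_le, Real.norm_of_nonneg (by positivity), ← div_eq_mul_inv,
      le_div_iff₀ (by positivity), mul_comm]
    refine le_trans ?_ (h (WithLp.toLp 2 (t, x)))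
    gcongr
    have h1 : ‖t‖ ≤ ‖(WithLp.toLp 2 (t, x) : SpaceTime d)‖ :=
      WithLp.norm_fst_le ℝ (WithLp.toLp 2 (t, x) : SpaceTime d)
    rw [Real.norm_eq_abs] at h1
    nlinarith [sq_abs t, abs_nonneg t]

/-- Plancherel on each slice gives the same norm at every time, since the phase has modulus one; the
test function supplies integrability in t. The constant does not depend on u or h, so truncations
converge. -/
lemma exists_eLpNorm_weighted_le (s : ℝ) (χ : 𝓢(SpaceTime d, ℂ)) :
    ∃ M : ℝ≥0∞, M ≠ ⊤ ∧ ∀ (u : ℝ × Space d → ℂ) (h : Space d → ℂ), AEStronglyMeasurable u volume →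
      (∀ t : ℝ, HasFourierTransform (fun x => u (t, x))
        (fun ξ => Complex.exp (Complex.I * ((t * phi s ‖ξ‖ : ℝ) : ℂ)) * h ξ)) →
      eLpNorm u 2 (weighted χ) ≤ M * eLpNorm h 2 volume := by
  obtain ⟨C, hC, m, hm, hmC, hχ⟩ := exists_time_bound χ
  set K : ℝ≥0∞ := C * ENNReal.ofReal ((2 * Real.pi) ^ d)⁻¹
  have hK : K ≠ ⊤ := by finiteness
  -- K + 1 replaces √K, since K ≤ (K + 1)².
  refine ⟨K + 1, by finiteness, fun u h hu hev => ?_⟩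
  have hsq : eLpNorm u 2 (weighted χ) ^ 2 ≤ K * eLpNorm h 2 volume ^ 2 := by
    rw [eLpNorm_two_sq, eLpNorm_two_sq, lintegral_weighted χ (by fun_prop),
      Measure.volume_eq_prod, lintegral_prod]
    · calc ∫⁻ t, ∫⁻ x, ‖χ (WithLp.toLp 2 (t, x))‖ₑ * ‖u (t, x)‖ₑ ^ 2
          ≤ ∫⁻ t, m t * (ENNReal.ofReal ((2 * Real.pi) ^ d)⁻¹ * ∫⁻ ξ, ‖h ξ‖ₑ ^ 2) := by
            refine lintegral_mono fun t => ?_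
            have h1 := (hev t).lintegral_sq_eq
            simp only [enorm_mul] at h1
            have h2 (ξ : Space d) :
                ‖Complex.exp (Complex.I * ((t * phi s ‖ξ‖ : ℝ) : ℂ))‖ₑ = 1 := by
              rw [← ofReal_norm, norm_exp_I_mul, ENNReal.ofReal_one]
            simp only [h2, one_mul] at h1
            rw [← h1]
            refine (lintegral_mono fun x => mul_le_mul_left (hχ t x) _).trans ?_
            refine (lintegral_const_mul'' _ ?_).le
            have := (hasFourierTransform_iff.1 (hev t)).1.locallyIntegrable.aestronglyMeasurable
            exact this.enorm.pow_const 2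
        _ = (∫⁻ t, m t) * (ENNReal.ofReal ((2 * Real.pi) ^ d)⁻¹ * ∫⁻ ξ, ‖h ξ‖ₑ ^ 2) :=
            lintegral_mul_const _ hm
        _ ≤ _ := by
            rw [← mul_assoc]
            exact mul_le_mul_left (mul_le_mul_left hmC _) _
    · rw [← Measure.volume_eq_prod]
      exact ((continuous_test χ).enorm.measurable.aemeasurable).mul (hu.enorm.pow_const 2)
  refine (ENNReal.pow_le_pow_left_iff two_ne_zero).1 (hsq.trans ?_)
  rw [mul_pow]
  gcongr
  calc K ≤ (K + 1) * 1 := by rw [mul_one]; exact le_self_add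
    _ ≤ (K + 1) ^ 2 := by
      rw [sq]; gcongr; exact le_add_self

/-- The restriction of `h` to the ball of radius `n`. -/
noncomputable def truncate (h : Space d → ℂ) (n : ℕ) : Space d → ℂ :=
  (Metric.ball (0 : Space d) n).indicator h

lemma integrable_truncate {h : Space d → ℂ} (hh : MemLp h 2) (n : ℕ) :
    Integrable (truncate h n) := by
  rw [truncate, integrable_indicator_iff measurableSet_ball]
  have : IsFiniteMeasure ((volume : Measure (Space d)).restrict (Metric.ball 0 n)) :=
    ⟨by simpa using measure_ball_lt_top⟩
  exact (hh.restrict _).integrable (by norm_num)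

lemma norm_truncate_le (h : Space d → ℂ) (n : ℕ) (y : Space d) : ‖truncate h n y‖ ≤ ‖h y‖ :=
  norm_indicator_le_norm_self _ _

lemma eventually_truncate_eq (h : Space d → ℂ) (y : Space d) :
    ∀ᶠ n : ℕ in atTop, truncate h n y = h y := by
  obtain ⟨N, hN⟩ := exists_nat_gt ‖y‖
  filter_upwards [eventually_ge_atTop N] with n hn
  refine Set.indicator_of_mem ?_ _
  rw [mem_ball_zero_iff]
  exact hN.trans_le (by exact_mod_cast hn)

lemma tendsto_eLpNorm_sub_truncate {h : Space d → ℂ} (hh : MemLp h 2) :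
    Tendsto (fun n => eLpNorm (fun y => h y - truncate h n y) 2 volume) atTop (𝓝 0) := by
  have h1 : Tendsto (fun n => ∫⁻ y, ‖h y - truncate h n y‖ₑ ^ 2) atTop
      (𝓝 (∫⁻ _ : Space d, 0)) := by
    refine tendsto_lintegral_of_dominated_convergence' (fun y => ‖h y‖ₑ ^ 2) ?_ ?_ ?_ ?_
    · intro n
      have := hh.1.sub ((integrable_truncate hh n).1)
      exact this.enorm.pow_const 2
    · intro n
      refine Eventually.of_forall fun y => ?_
      by_cases hy : y ∈ Metric.ball (0 : Space d) n <;> simp only [truncate, hy,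
        Set.indicator_of_mem, Set.indicator_of_notMem, not_false_eq_true] <;> simp
    · rw [← eLpNorm_two_sq]
      finiteness [hh.2.ne]
    · refine Eventually.of_forall fun y => ?_
      refine tendsto_const_nhds.congr' ?_
      filter_upwards [eventually_truncate_eq h y] with n hn
      simp [hn]
  rw [lintegral_zero] at h1
  have h2 := (ENNReal.continuous_rpow_const (y := 1 / 2)).tendsto 0 |>.comp h1
  simp only [one_div, ENNReal.zero_rpow_of_pos (by norm_num : (0 : ℝ) < 2⁻¹)] at h2
  refine h2.congr fun n => ?_
  rw [eLpNorm_eq_lintegral_rpow_enorm_toReal two_ne_zero ENNReal.ofNat_ne_top]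
  simp

/-- Only the L² part is truncated. The truncated data are integrable, and the error propagates the
data `h - truncate h n`, which tend to 0 in L². -/
lemma tendsto_eLpNorm_sub_wave {s : ℝ} {u : ℝ × Space d → ℂ} {g h : Space d → ℂ}
    (hu : AEStronglyMeasurable u volume) (hg : Integrable g) (hh : MemLp h 2)
    (hev : ∀ t : ℝ, HasFourierTransform (fun x => u (t, x))
      (fun ξ => Complex.exp (Complex.I * ((t * phi s ‖ξ‖ : ℝ) : ℂ)) * (g ξ + h ξ)))
    (χ : 𝓢(SpaceTime d, ℂ)) :
    Tendsto (fun n => eLpNorm (u - wave s (fun ξ => g ξ + truncate h n ξ)) 2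
      (weighted χ)) atTop (𝓝 0) := by
  obtain ⟨M, hM, hle⟩ := exists_eLpNorm_weighted_le s χ
  have hlim := ENNReal.Tendsto.const_mul (a := M) (tendsto_eLpNorm_sub_truncate hh) (Or.inr hM)
  rw [mul_zero] at hlim
  refine tendsto_of_tendsto_of_tendsto_of_le_of_le tendsto_const_nhds hlim
    (fun n => bot_le) fun n => ?_
  have hgn : Integrable (fun ξ => g ξ + truncate h n ξ) := hg.add (integrable_truncate hh n)
  refine hle _ _ (hu.sub (continuous_wave s hgn).aestronglyMeasurable) fun t => ?_
  have h1 := (hev t).sub (hasFourierTransform_wave s hgn t)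
  convert h1 using 2 with x ξ
  · rfl
  · ring

lemma memLp_wave_weighted (s : ℝ) {g : Space d → ℂ} (hg : Integrable g)
    (χ : 𝓢(SpaceTime d, ℂ)) : MemLp (wave s g) 2 (weighted χ) :=
  MemLp.of_bound (continuous_wave s hg).aestronglyMeasurable _
    (Eventually.of_forall fun z => norm_wave_le s g z)

lemma memLp_weighted {s : ℝ} {u : ℝ × Space d → ℂ} {g h : Space d → ℂ}
    (hu : AEStronglyMeasurable u volume) (hg : Integrable g) (hh : MemLp h 2)
    (hev : ∀ t : ℝ, HasFourierTransform (fun x => u (t, x))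
      (fun ξ => Complex.exp (Complex.I * ((t * phi s ‖ξ‖ : ℝ) : ℂ)) * (g ξ + h ξ)))
    (χ : 𝓢(SpaceTime d, ℂ)) : MemLp u 2 (weighted χ) := by
  have h1 := tendsto_eLpNorm_sub_wave hu hg hh hev χ
  obtain ⟨n, hn⟩ := (h1.eventually (gt_mem_nhds ENNReal.zero_lt_top)).exists
  have hw : MemLp (wave s (fun ξ => g ξ + truncate h n ξ)) 2 (weighted χ) :=
    memLp_wave_weighted s (hg.add (integrable_truncate hh n)) χ
  have h2 : MemLp (u - wave s (fun ξ => g ξ + truncate h n ξ)) 2 (weighted χ) :=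
    ⟨(hu.mono_ac (weighted_absolutelyContinuous χ)).sub hw.1, hn⟩
  simpa using h2.add hw

lemma integrable_mul_test {χ : 𝓢(SpaceTime d, ℂ)} {F : ℝ × Space d → ℂ}
    (hF : AEStronglyMeasurable F volume) (h : eLpNorm F 1 (weighted χ) ≠ ⊤) :
    Integrable (fun z => F z * χ (WithLp.toLp 2 z)) := by
  refine ⟨hF.mul (continuous_test χ).aestronglyMeasurable, ?_⟩
  rw [HasFiniteIntegral]
  simp only [enorm_mul, mul_comm ‖F _‖ₑ]
  rw [← lintegral_weighted χ hF.enorm, ← eLpNorm_one_eq_lintegral_enorm]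
  exact h.lt_top

lemma enorm_integral_mul_test_le (χ : 𝓢(SpaceTime d, ℂ)) {F : ℝ × Space d → ℂ}
    (hF : AEStronglyMeasurable F volume) :
    ‖∫ z, F z * χ (WithLp.toLp 2 z)‖ₑ ≤ eLpNorm F 1 (weighted χ) := by
  refine (enorm_integral_le_lintegral_enorm _).trans_eq ?_
  simp only [enorm_mul, mul_comm ‖F _‖ₑ]
  rw [← lintegral_weighted χ hF.enorm, ← eLpNorm_one_eq_lintegral_enorm]

lemma eLpNorm_one_mul_le {α : Type*} [MeasurableSpace α] {μ : Measure α} {F G : α → ℂ}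
    (hF : AEStronglyMeasurable F μ) (hG : AEStronglyMeasurable G μ) :
    eLpNorm (fun z => F z * G z) 1 μ ≤ eLpNorm F 2 μ * eLpNorm G 2 μ := by
  have := eLpNorm_smul_le_mul_eLpNorm (p := 2) (q := 2) (r := 1) hG hF
  exact this

lemma integrable_norm_add_norm_mul {g h : Space d → ℂ} (hg : Integrable g) (hh : MemLp h 2) :
    Integrable (fun y => (‖g y‖ + ‖h y‖) * ((1 + ‖y‖) ^ (d + 1))⁻¹) := by
  simp only [add_mul]
  exact (integrable_mul_inv_one_add_norm_pow hg).add
    (integrable_mul_inv_one_add_norm_pow_of_memLp hh)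

lemma integrable_prod_bound {g₁ h₁ g₂ h₂ : Space d → ℂ} (hg₁ : Integrable g₁) (hh₁ : MemLp h₁ 2)
    (hg₂ : Integrable g₂) (hh₂ : MemLp h₂ 2) (C : ℝ) :
    Integrable (fun y : Space d × Space d => (‖g₁ y.1‖ + ‖h₁ y.1‖) * (‖g₂ y.2‖ + ‖h₂ y.2‖) *
      (C * (((1 + ‖y.1‖) ^ (d + 1))⁻¹ * ((1 + ‖y.2‖) ^ (d + 1))⁻¹))) := by
  refine (((integrable_norm_add_norm_mul hg₁ hh₁).mul_prod
    (integrable_norm_add_norm_mul hg₂ hh₂)).const_mul C).congr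
      (Eventually.of_forall fun y => ?_)
  ring

lemma norm_mul_mul_le {a b c : ℂ} {A B C : ℝ} (ha : ‖a‖ ≤ A) (hb : ‖b‖ ≤ B) (hc : ‖c‖ ≤ C) :
    ‖a * b * c‖ ≤ A * B * C := by
  have hA := (norm_nonneg a).trans ha
  have hB := (norm_nonneg b).trans hb
  rw [norm_mul, norm_mul]
  gcongr

lemma aestronglyMeasurable_prod_mul {F₁ F₂ : Space d → ℂ} (h₁ : AEStronglyMeasurable F₁ volume)
    (h₂ : AEStronglyMeasurable F₂ volume) :
    AEStronglyMeasurable (fun y : Space d × Space d => F₁ y.1 * F₂ y.2) volume :=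
  h₁.comp_fst.mul h₂.comp_snd

lemma integrable_mul_energyMomentum (s : ℝ) {F₁ F₂ : Space d → ℂ}
    (h₁ : MemL1AddL2 F₁) (h₂ : MemL1AddL2 F₂) (X : 𝓢(SpaceTime d, ℂ)) :
    Integrable (fun y : Space d × Space d =>
      F₁ y.1 * F₂ y.2 * X (WithLp.toLp 2 (energyMomentum s y))) := by
  obtain ⟨g₁, k₁, hg₁, hk₁, rfl⟩ := h₁
  obtain ⟨g₂, k₂, hg₂, hk₂, rfl⟩ := h₂
  obtain ⟨C, hC, hX⟩ := norm_schwartz_energyMomentum_le s X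
  refine (integrable_prod_bound (memLp_one_iff_integrable.1 hg₁) hk₁
    (memLp_one_iff_integrable.1 hg₂) hk₂ C).mono' ?_ (Eventually.of_forall fun y => ?_)
  · exact (aestronglyMeasurable_prod_mul (hg₁.1.add hk₁.1) (hg₂.1.add hk₂.1)).mul
      ((continuous_test X).comp (continuous_energyMomentum s)).aestronglyMeasurable
  · exact norm_mul_mul_le (norm_add_le _ _) (norm_add_le _ _) (hX y)

lemma tendsto_integral_truncate (s : ℝ) {g₁ h₁ g₂ h₂ : Space d → ℂ} (hg₁ : Integrable g₁)
    (hh₁ : MemLp h₁ 2) (hg₂ : Integrable g₂) (hh₂ : MemLp h₂ 2) (X : 𝓢(SpaceTime d, ℂ)) :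
    Tendsto (fun n => ∫ y : Space d × Space d, (g₁ y.1 + truncate h₁ n y.1) *
      (g₂ y.2 + truncate h₂ n y.2) * X (WithLp.toLp 2 (energyMomentum s y))) atTop
      (𝓝 (∫ y : Space d × Space d, (g₁ y.1 + h₁ y.1) * (g₂ y.2 + h₂ y.2) *
        X (WithLp.toLp 2 (energyMomentum s y)))) := by
  obtain ⟨C, hC, hX⟩ := norm_schwartz_energyMomentum_le s X
  refine tendsto_integral_of_dominated_convergence _ (fun n => ?_)
    (integrable_prod_bound hg₁ hh₁ hg₂ hh₂ C) (fun n => Eventually.of_forall fun y => ?_)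
    (Eventually.of_forall fun y => ?_)
  · exact (aestronglyMeasurable_prod_mul (hg₁.1.add (integrable_truncate hh₁ n).1)
      (hg₂.1.add (integrable_truncate hh₂ n).1)).mul
      ((continuous_test X).comp (continuous_energyMomentum s)).aestronglyMeasurable
  · refine norm_mul_mul_le ((norm_add_le _ _).trans ?_) ((norm_add_le _ _).trans ?_) (hX y) <;>
    · gcongr
      exact norm_truncate_le _ _ _
  · refine tendsto_const_nhds.congr' ?_
    filter_upwards [eventually_truncate_eq h₁ y.1, eventually_truncate_eq h₂ y.2] with n e₁ e₂
    rw [e₁, e₂]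

lemma tendsto_integral_mul_of_tendsto_eLpNorm {χ : 𝓢(SpaceTime d, ℂ)} {u₁ u₂ : ℝ × Space d → ℂ}
    {w₁ w₂ : ℕ → ℝ × Space d → ℂ}
    (hu₁ : AEStronglyMeasurable u₁ volume) (hu₂ : AEStronglyMeasurable u₂ volume)
    (hw₁ : ∀ n, AEStronglyMeasurable (w₁ n) volume)
    (hw₂ : ∀ n, AEStronglyMeasurable (w₂ n) volume)
    (hL₁ : MemLp u₁ 2 (weighted χ)) (hL₂ : MemLp u₂ 2 (weighted χ))
    (h₁ : Tendsto (fun n => eLpNorm (u₁ - w₁ n) 2 (weighted χ)) atTop (𝓝 0))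
    (h₂ : Tendsto (fun n => eLpNorm (u₂ - w₂ n) 2 (weighted χ)) atTop (𝓝 0)) :
    Tendsto (fun n => ∫ z, w₁ n z * w₂ n z * χ (WithLp.toLp 2 z)) atTop
      (𝓝 (∫ z, u₁ z * u₂ z * χ (WithLp.toLp 2 z))) := by
  have hac := weighted_absolutelyContinuous χ
  have key (a b : ℝ × Space d → ℂ) (ha : AEStronglyMeasurable a volume)
      (hb : AEStronglyMeasurable b volume) :
      eLpNorm (fun z => a z * b z) 1 (weighted χ) ≤
        eLpNorm a 2 (weighted χ) * eLpNorm b 2 (weighted χ) :=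
    eLpNorm_one_mul_le (ha.mono_ac hac) (hb.mono_ac hac)
  have hev : ∀ᶠ n in atTop, eLpNorm (u₁ - w₁ n) 2 (weighted χ) < ⊤ ∧
      eLpNorm (u₂ - w₂ n) 2 (weighted χ) < ⊤ :=
    (h₁.eventually (gt_mem_nhds ENNReal.zero_lt_top)).and
      (h₂.eventually (gt_mem_nhds ENNReal.zero_lt_top))
  have hlim : Tendsto (fun n => eLpNorm (u₁ - w₁ n) 2 (weighted χ) * eLpNorm u₂ 2 (weighted χ) +
      (eLpNorm u₁ 2 (weighted χ) + eLpNorm (u₁ - w₁ n) 2 (weighted χ)) *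
        eLpNorm (u₂ - w₂ n) 2 (weighted χ)) atTop (𝓝 0) := by
    have a1 := ENNReal.Tendsto.mul_const h₁ (Or.inr hL₂.2.ne)
    have a2 := ENNReal.Tendsto.mul (tendsto_const_nhds.add h₁)
      (Or.inr ENNReal.zero_ne_top) h₂ (Or.inr (by simpa using hL₁.2.ne))
    simpa using a1.add a2
  rw [tendsto_iff_edist_tendsto_0]
  refine tendsto_of_tendsto_of_tendsto_of_le_of_le' tendsto_const_nhds hlim
    (Eventually.of_forall fun n => bot_le) ?_
  filter_upwards [hev] with n hn
  have hw₁L : MemLp (w₁ n) 2 (weighted χ) := by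
    have : MemLp (u₁ - w₁ n) 2 (weighted χ) := ⟨(hu₁.sub (hw₁ n)).mono_ac hac, hn.1⟩
    simpa using hL₁.sub this
  have hw₂L : MemLp (w₂ n) 2 (weighted χ) := by
    have : MemLp (u₂ - w₂ n) 2 (weighted χ) := ⟨(hu₂.sub (hw₂ n)).mono_ac hac, hn.2⟩
    simpa using hL₂.sub this
  have i1 : Integrable (fun z => u₁ z * u₂ z * χ (WithLp.toLp 2 z)) :=
    integrable_mul_test (hu₁.mul hu₂)
      ((key _ _ hu₁ hu₂).trans_lt (ENNReal.mul_lt_top hL₁.2 hL₂.2)).ne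
  have i2 : Integrable (fun z => w₁ n z * w₂ n z * χ (WithLp.toLp 2 z)) :=
    integrable_mul_test ((hw₁ n).mul (hw₂ n))
      ((key _ _ (hw₁ n) (hw₂ n)).trans_lt (ENNReal.mul_lt_top hw₁L.2 hw₂L.2)).ne
  -- Telescoping: each summand contains one factor that tends to 0 in the weighted L² norm.
  have hsub : u₁ * u₂ - w₁ n * w₂ n =
      (fun z => (u₁ - w₁ n) z * u₂ z) + fun z => w₁ n z * (u₂ - w₂ n) z := by
    ext z; simp only [Pi.add_apply, Pi.sub_apply, Pi.mul_apply]; ring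
  rw [edist_comm, edist_eq_enorm_sub, ← integral_sub i1 i2]
  simp only [← sub_mul]
  refine (enorm_integral_mul_test_le χ ((hu₁.mul hu₂).sub ((hw₁ n).mul (hw₂ n)))).trans ?_
  rw [hsub]
  refine (eLpNorm_add_le ?_ ?_ le_rfl).trans ?_
  · exact (((hu₁.sub (hw₁ n)).mul hu₂)).mono_ac hac
  · exact (((hw₁ n).mul (hu₂.sub (hw₂ n)))).mono_ac hac
  refine add_le_add (key _ _ (hu₁.sub (hw₁ n)) hu₂)
    ((key _ _ (hw₁ n) (hu₂.sub (hw₂ n))).trans ?_)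
  gcongr
  have : w₁ n = u₁ - (u₁ - w₁ n) := by abel
  conv_lhs => rw [this]
  exact eLpNorm_sub_le hL₁.1 ((hu₁.sub (hw₁ n)).mono_ac hac) (by norm_num)

/-- The space-time Fourier transform of the product of two propagations is the image of
`f̂₁(y₁) f̂₂(y₂) dy₁ dy₂` under the energy-momentum map. -/
theorem IsPropagation.integral_mul_test {s : ℝ} {f₁ f₂ F₁ F₂ : Space d → ℂ}
    {u₁ u₂ : ℝ × Space d → ℂ} (h₁ : IsPropagation s f₁ F₁ u₁) (h₂ : IsPropagation s f₂ F₂ u₂)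
    (χ : 𝓢(SpaceTime d, ℂ)) :
    Integrable (fun z => u₁ z * u₂ z * χ (WithLp.toLp 2 z)) ∧
    ∫ z, u₁ z * u₂ z * χ (WithLp.toLp 2 z) =
      ((((2 * Real.pi) ^ (2 * d))⁻¹ : ℝ) : ℂ) * ∫ y : Space d × Space d,
        F₁ y.1 * F₂ y.2 * conjFourier χ (WithLp.toLp 2 (energyMomentum s y)) := by
  obtain ⟨⟨g₁, k₁, hg₁, hk₁, rfl⟩, -, hu₁, hev₁⟩ := h₁
  obtain ⟨⟨g₂, k₂, hg₂, hk₂, rfl⟩, -, hu₂, hev₂⟩ := h₂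
  rw [memLp_one_iff_integrable] at hg₁ hg₂
  have hL₁ := memLp_weighted hu₁ hg₁ hk₁ hev₁ χ
  have hL₂ := memLp_weighted hu₂ hg₂ hk₂ hev₂ χ
  refine ⟨integrable_mul_test (hu₁.mul hu₂)
    ((eLpNorm_one_mul_le hL₁.1 hL₂.1).trans_lt (ENNReal.mul_lt_top hL₁.2 hL₂.2)).ne, ?_⟩
  obtain ⟨X, hX⟩ := exists_schwartz_conjFourier χ
  have i₁ (n) : Integrable (fun ξ => g₁ ξ + truncate k₁ n ξ) := hg₁.add (integrable_truncate hk₁ n)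
  have i₂ (n) : Integrable (fun ξ => g₂ ξ + truncate k₂ n ξ) := hg₂.add (integrable_truncate hk₂ n)
  have l1 := tendsto_integral_mul_of_tendsto_eLpNorm hu₁ hu₂
    (fun n => (continuous_wave s (i₁ n)).aestronglyMeasurable)
    (fun n => (continuous_wave s (i₂ n)).aestronglyMeasurable) hL₁ hL₂
    (tendsto_eLpNorm_sub_wave hu₁ hg₁ hk₁ hev₁ χ) (tendsto_eLpNorm_sub_wave hu₂ hg₂ hk₂ hev₂ χ)
  have l2 := (tendsto_integral_truncate s hg₁ hk₁ hg₂ hk₂ X).const_mul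
    ((((2 * Real.pi) ^ (2 * d))⁻¹ : ℝ) : ℂ)
  simp_rw [hX] at l2
  -- For each n the data are integrable and the identity is `integral_wave_mul_wave`; both sides
  -- converge.
  refine tendsto_nhds_unique l1 (l2.congr fun n => ?_)
  rw [integral_wave_mul_wave s (i₁ n) (i₂ n) χ]

end General

/-! ### The Lorentz boost from the centre of mass frame. -/

section Boost

variable {d : ℕ}

lemma phi_sq (s r : ℝ) : phi s r ^ 2 = s ^ 2 + r ^ 2 := Real.sq_sqrt (by positivity)

lemma phi_norm_pos {s : ℝ} {w : Space d} (hw : w ≠ 0) : 0 < phi s ‖w‖ :=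
  (norm_pos_iff.2 hw).trans_le (le_phi s _)

/-- The invariant mass of two particles of relative momentum `w` in the centre of mass frame. -/
noncomputable def invMass (s : ℝ) (w : Space d) : ℝ := 2 * phi s ‖w‖

/-- The energy of a system of momentum `ξ` with invariant mass `invMass s w`. -/
noncomputable def boostEnergy (s : ℝ) (ξ w : Space d) : ℝ := √(invMass s w ^ 2 + ‖ξ‖ ^ 2)

/-- The coefficient of `ξ` in the boost. -/
noncomputable def boostCoeff (s : ℝ) (ξ w : Space d) : ℝ :=
  inner ℝ w ξ / (invMass s w * (boostEnergy s ξ w + invMass s w))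

/-- The momentum in the laboratory frame, where the total momentum is `ξ`, of the particle which
has momentum `w` in the centre of mass frame. -/
noncomputable def boost (s : ℝ) (ξ w : Space d) : Space d :=
  (2⁻¹ : ℝ) • ξ + w + boostCoeff s ξ w • ξ

lemma invMass_pos {s : ℝ} {w : Space d} (hw : w ≠ 0) : 0 < invMass s w :=
  mul_pos two_pos (phi_norm_pos hw)

lemma invMass_sq (s : ℝ) (w : Space d) : invMass s w ^ 2 = 4 * (s ^ 2 + ‖w‖ ^ 2) := by
  rw [invMass, mul_pow, phi_sq]; norm_num

lemma boostEnergy_sq (s : ℝ) (ξ w : Space d) :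
    boostEnergy s ξ w ^ 2 = invMass s w ^ 2 + ‖ξ‖ ^ 2 := Real.sq_sqrt (by positivity)

lemma boostEnergy_pos {s : ℝ} (ξ : Space d) {w : Space d} (hw : w ≠ 0) :
    0 < boostEnergy s ξ w := by
  have := invMass_pos (s := s) hw
  exact Real.sqrt_pos.2 (by positivity)

/-- In the centre of mass frame the second particle has momentum -w. -/
lemma sub_boost (s : ℝ) (ξ w : Space d) : ξ - boost s ξ w = boost s ξ (-w) := by
  have h : boostCoeff s ξ (-w) = -boostCoeff s ξ w := by
    simp [boostCoeff, boostEnergy, invMass, neg_div]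
  rw [boost, boost, h]
  module

/-- Time component of the boost of (M/2, w) with velocity ξ/τ, where τ is the total energy and M the
invariant mass. The squares agree by the mass shell relation; the sign comes from |w·ξ| ≤ (M/2) τ.
-/
lemma phi_boost {s : ℝ} (ξ : Space d) {w : Space d} (hw : w ≠ 0) :
    phi s ‖boost s ξ w‖ = boostEnergy s ξ w / 2 + inner ℝ w ξ / invMass s w := by
  have hM := invMass_pos (s := s) hw
  have hτ := boostEnergy_pos (s := s) ξ hw
  have hτ2 := boostEnergy_sq s ξ w
  have hM2 := invMass_sq s w
  have hq := abs_real_inner_le_norm w ξ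
  have hb : ‖boost s ξ w‖ ^ 2 = ‖ξ‖ ^ 2 / 4 + ‖w‖ ^ 2 + boostCoeff s ξ w ^ 2 * ‖ξ‖ ^ 2 +
      inner ℝ w ξ + boostCoeff s ξ w * ‖ξ‖ ^ 2 + 2 * boostCoeff s ξ w * inner ℝ w ξ := by
    rw [← real_inner_self_eq_norm_sq, ← real_inner_self_eq_norm_sq, ← real_inner_self_eq_norm_sq,
      boost]
    simp only [inner_add_left, inner_add_right, real_inner_smul_left, real_inner_smul_right,
      real_inner_comm w ξ]
    ring
  have hx : ‖ξ‖ ^ 2 = boostEnergy s ξ w ^ 2 - invMass s w ^ 2 := by linarith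
  have hw2 : ‖w‖ ^ 2 = invMass s w ^ 2 / 4 - s ^ 2 := by linarith
  have hxτ : ‖ξ‖ ≤ boostEnergy s ξ w := Real.le_sqrt_of_sq_le (le_add_of_nonneg_left (sq_nonneg _))
  have hwM : ‖w‖ ≤ invMass s w / 2 := by rw [invMass]; linarith [le_phi s ‖w‖]
  have hnn : 0 ≤ boostEnergy s ξ w / 2 + inner ℝ w ξ / invMass s w := by
    have h1 : ‖w‖ * ‖ξ‖ ≤ invMass s w / 2 * boostEnergy s ξ w := by gcongr
    have h2 : -(invMass s w / 2 * boostEnergy s ξ w) ≤ inner ℝ w ξ := by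
      linarith [neg_abs_le (inner ℝ w ξ)]
    have h3 : -(boostEnergy s ξ w / 2) ≤ inner ℝ w ξ / invMass s w := by
      rw [le_div_iff₀ hM]; linarith
    linarith
  have hsq : s ^ 2 + ‖boost s ξ w‖ ^ 2 =
      (boostEnergy s ξ w / 2 + inner ℝ w ξ / invMass s w) ^ 2 := by
    rw [hb, hx, hw2, boostCoeff]
    generalize boostEnergy s ξ w = τ at *
    generalize invMass s w = M at *
    have : τ + M ≠ 0 := by positivity
    field_simp
    ring
  rw [phi, hsq, Real.sqrt_sq hnn]

lemma phi_sub_boost {s : ℝ} (ξ : Space d) {w : Space d} (hw : w ≠ 0) :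
    phi s ‖ξ - boost s ξ w‖ = boostEnergy s ξ w / 2 - inner ℝ w ξ / invMass s w := by
  rw [sub_boost, phi_boost ξ (neg_ne_zero.2 hw)]
  simp [boostEnergy, invMass, neg_div, sub_eq_add_neg]

/-- Up to a constant, the boost is the identity plus a scalar function times ξ. Its derivative is
therefore a rank one perturbation of the identity, with determinant 1 plus the derivative of
`boostCoeff` in the direction ξ, which is computed along the line w + tξ. -/
lemma hasFDerivAt_boost {s : ℝ} (ξ : Space d) {w : Space d} (hw : w ≠ 0) :
    ∃ T' : Space d →L[ℝ] Space d, HasFDerivAt (boost s ξ) T' w ∧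
      T'.det = boostEnergy s ξ w / invMass s w -
        4 * inner ℝ w ξ ^ 2 / (boostEnergy s ξ w * invMass s w ^ 3) := by
  have hM := invMass_pos (s := s) hw
  have hτ := boostEnergy_pos (s := s) ξ hw
  have hτ2 := boostEnergy_sq s ξ w
  have hphi := phi_norm_pos (s := s) hw
  have hs0 : s ^ 2 + ‖w‖ ^ 2 ≠ 0 := by rw [← phi_sq]; positivity
  have dM : DifferentiableAt ℝ (invMass s : Space d → ℝ) w := by
    unfold invMass phi
    exact (((differentiableAt_id.norm_sq ℝ).const_add _).sqrt hs0).const_mul _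
  have dτ : DifferentiableAt ℝ (boostEnergy s ξ) w := by
    unfold boostEnergy
    have hne : invMass s w ^ 2 + ‖ξ‖ ^ 2 ≠ 0 := by positivity
    exact ((dM.pow 2).add_const _).sqrt hne
  have dκ : DifferentiableAt ℝ (boostCoeff s ξ) w := by
    have hne : invMass s w * (boostEnergy s ξ w + invMass s w) ≠ 0 := by positivity
    have h1 : DifferentiableAt ℝ
        (fun w => invMass s w * (boostEnergy s ξ w + invMass s w)) w := dM.mul (dτ.add dM)
    have h2 : DifferentiableAt ℝ (fun w : Space d => (inner ℝ w ξ : ℝ)) w :=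
      differentiableAt_id.inner ℝ (differentiableAt_const _)
    unfold boostCoeff
    simp only [div_eq_mul_inv]
    exact h2.mul (h1.fun_inv hne)
  refine ⟨ContinuousLinearMap.id ℝ _ + (fderiv ℝ (boostCoeff s ξ) w).smulRight ξ, ?_, ?_⟩
  · unfold boost
    exact ((hasFDerivAt_id w).const_add _).add (dκ.hasFDerivAt.smul_const ξ)
  have hdet : (ContinuousLinearMap.id ℝ _ + (fderiv ℝ (boostCoeff s ξ) w).smulRight ξ).det =
      1 + fderiv ℝ (boostCoeff s ξ) w ξ := by
    rw [← ContinuousLinearMap.coe_coe (fderiv ℝ (boostCoeff s ξ) w), ← LinearMap.transvection.det,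
      ContinuousLinearMap.det]
    rfl
  rw [hdet]
  have hline : HasDerivAt (fun t : ℝ => w + t • ξ) ξ 0 := by
    simpa using ((hasDerivAt_id (0 : ℝ)).smul_const ξ).const_add w
  have hw0 : w + (0 : ℝ) • ξ = w := by simp
  have h1 : HasDerivAt (fun t : ℝ => boostCoeff s ξ (w + t • ξ)) (fderiv ℝ (boostCoeff s ξ) w ξ) 0 := by
    have := dκ.hasFDerivAt
    rw [← hw0] at this
    simpa [hw0, Function.comp_def] using this.comp_hasDerivAt (0 : ℝ) hline
  have hn : HasDerivAt (fun t : ℝ => s ^ 2 + ‖w + t • ξ‖ ^ 2) (2 * inner ℝ w ξ) 0 := by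
    simpa [hw0] using (hline.norm_sq).const_add (s ^ 2)
  have hMd : HasDerivAt (fun t : ℝ => invMass s (w + t • ξ))
      (4 * inner ℝ w ξ / invMass s w) 0 := by
    unfold invMass phi
    refine ((hn.sqrt (by rwa [hw0])).const_mul 2).congr_deriv ?_
    rw [hw0]
    field_simp
    ring
  have hτd : HasDerivAt (fun t : ℝ => boostEnergy s ξ (w + t • ξ))
      (4 * inner ℝ w ξ / boostEnergy s ξ w) 0 := by
    have h2 := (((hMd.pow 2).add_const (‖ξ‖ ^ 2)).sqrt (by rw [Pi.pow_apply, hw0]; positivity))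
    refine h2.congr_deriv ?_
    simp only [Pi.pow_apply, hw0]
    rw [← boostEnergy]
    field_simp
    ring
  have hq : HasDerivAt (fun t : ℝ => inner ℝ (w + t • ξ) ξ) (‖ξ‖ ^ 2) 0 := by
    simpa using hline.inner ℝ (hasDerivAt_const (0 : ℝ) ξ)
  have h3 := (hq.div (hMd.mul (hτd.add hMd)) (by simp only [hw0, Pi.mul_apply, Pi.add_apply]; positivity)).unique h1
  simp only [hw0, Pi.mul_apply, Pi.add_apply] at h3
  rw [← h3, show ‖ξ‖ ^ 2 = boostEnergy s ξ w ^ 2 - invMass s w ^ 2 by linarith]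
  generalize boostEnergy s ξ w = τ at *
  generalize invMass s w = M at *
  have : τ + M ≠ 0 := by positivity
  field_simp
  ring

/-- The quantity `φ_s(|y₁|) φ_s(|y₂|) - y₁·y₂`. -/
noncomputable def minkowski (s : ℝ) (y₁ y₂ : Space d) : ℝ :=
  phi s ‖y₁‖ * phi s ‖y₂‖ - inner ℝ y₁ y₂

/-- The squared invariant mass. Through this identity `minkowski`, and with it the kernel, is a
function of the energy-momentum vector. -/
lemma sq_energy_sub_sq_momentum (s : ℝ) (y₁ y₂ : Space d) :
    (phi s ‖y₁‖ + phi s ‖y₂‖) ^ 2 - ‖y₁ + y₂‖ ^ 2 = 2 * (minkowski s y₁ y₂ + s ^ 2) := by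
  rw [add_sq, phi_sq, phi_sq, @norm_add_sq_real, minkowski]
  ring

/-- By Lorentz invariance this is the value for the momenta w and -w. -/
lemma minkowski_boost {s : ℝ} (ξ : Space d) {w : Space d} (hw : w ≠ 0) :
    minkowski s (boost s ξ w) (ξ - boost s ξ w) = 2 * ‖w‖ ^ 2 + s ^ 2 := by
  have h := sq_energy_sub_sq_momentum s (boost s ξ w) (ξ - boost s ξ w)
  rw [phi_boost ξ hw, phi_sub_boost ξ hw, add_sub_cancel, add_add_sub_cancel, add_halves] at h
  have h2 := boostEnergy_sq s ξ w
  rw [invMass_sq] at h2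
  linarith

/-- The inverse of the boost. -/
noncomputable def unboost (s : ℝ) (ξ y : Space d) : Space d :=
  y - (2⁻¹ : ℝ) • ξ - (inner ℝ (y - (2⁻¹ : ℝ) • ξ) ξ / ((phi s ‖y‖ + phi s ‖ξ - y‖) *
    (phi s ‖y‖ + phi s ‖ξ - y‖ + √((phi s ‖y‖ + phi s ‖ξ - y‖) ^ 2 - ‖ξ‖ ^ 2)))) • ξ

lemma unboost_boost {s : ℝ} (ξ : Space d) {w : Space d} (hw : w ≠ 0) :
    unboost s ξ (boost s ξ w) = w := by
  have hM := invMass_pos (s := s) hw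
  have hτ := boostEnergy_pos (s := s) ξ hw
  have hτ2 := boostEnergy_sq s ξ w
  have h1 : phi s ‖boost s ξ w‖ + phi s ‖ξ - boost s ξ w‖ = boostEnergy s ξ w := by
    rw [phi_boost ξ hw, phi_sub_boost ξ hw]; ring
  have h2 : boost s ξ w - (2⁻¹ : ℝ) • ξ = w + boostCoeff s ξ w • ξ := by rw [boost]; abel
  have h3 : √(boostEnergy s ξ w ^ 2 - ‖ξ‖ ^ 2) = invMass s w := by
    rw [hτ2, add_sub_cancel_right, Real.sqrt_sq hM.le]
  rw [unboost, h1, h2, h3, inner_add_left, real_inner_smul_left, real_inner_self_eq_norm_sq]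
  have h4 : (inner ℝ w ξ + boostCoeff s ξ w * ‖ξ‖ ^ 2) /
      (boostEnergy s ξ w * (boostEnergy s ξ w + invMass s w)) = boostCoeff s ξ w := by
    rw [show ‖ξ‖ ^ 2 = boostEnergy s ξ w ^ 2 - invMass s w ^ 2 by linarith, boostCoeff]
    generalize boostEnergy s ξ w = τ at *
    generalize invMass s w = M at *
    have : τ + M ≠ 0 := by positivity
    field_simp
    ring
  rw [h4]
  abel

/-- The hypothesis says that the squared invariant mass M² exceeds 4s². With w the unboosted
momentum, |w|² = M²/4 - s², so w ≠ 0, and M and the total energy are recovered from w. -/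
lemma boost_unboost {s : ℝ} {ξ y : Space d} (h : s ^ 2 < minkowski s y (ξ - y)) :
    unboost s ξ y ≠ 0 ∧ boost s ξ (unboost s ξ y) = y := by
  have hE := sq_energy_sub_sq_momentum s y (ξ - y)
  rw [add_sub_cancel] at hE
  have hy := phi_sq s ‖y‖
  have hy' := phi_sq s ‖ξ - y‖
  have hy0 := phi_nonneg s ‖y‖
  have hy0' := phi_nonneg s ‖ξ - y‖
  set z := y - (2⁻¹ : ℝ) • ξ with hz
  have hyz : y = (2⁻¹ : ℝ) • ξ + z := by rw [hz]; abel
  have hyz' : ξ - y = (2⁻¹ : ℝ) • ξ - z := by rw [hz]; module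
  have hny : ‖y‖ ^ 2 = ‖ξ‖ ^ 2 / 4 + inner ℝ ξ z + ‖z‖ ^ 2 := by
    conv_lhs => rw [hyz, @norm_add_sq_real, norm_smul, real_inner_smul_left]
    norm_num
    ring
  have hny' : ‖ξ - y‖ ^ 2 = ‖ξ‖ ^ 2 / 4 - inner ℝ ξ z + ‖z‖ ^ 2 := by
    conv_lhs => rw [hyz', @norm_sub_sq_real, norm_smul, real_inner_smul_left]
    norm_num
    ring
  rw [hny] at hy
  rw [hny'] at hy'
  set a := phi s ‖y‖
  set b := phi s ‖ξ - y‖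
  set M := √((a + b) ^ 2 - ‖ξ‖ ^ 2) with hMdef
  have hMpos : 0 < (a + b) ^ 2 - ‖ξ‖ ^ 2 := by linarith [sq_nonneg s]
  have hM : 0 < M := Real.sqrt_pos.2 hMpos
  have hM2 : M ^ 2 = (a + b) ^ 2 - ‖ξ‖ ^ 2 := Real.sq_sqrt hMpos.le
  have hτ : 0 < a + b := by
    have h0 : 0 < (a + b) ^ 2 := by linarith [sq_nonneg ‖ξ‖]
    exact lt_of_le_of_ne (add_nonneg hy0 hy0') fun h => by simp [← h] at h0
  -- Here a and b are the two energies, and a² - b² = |y|² - |ξ - y|² = 2 z·ξ.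
  have hzξ : inner ℝ z ξ = (a + b) * (a - b) / 2 := by
    rw [real_inner_comm]; linear_combination (hy' - hy) / 2
  have hz2 : ‖z‖ ^ 2 = ((a + b) ^ 2 + (a - b) ^ 2) / 4 - s ^ 2 - ‖ξ‖ ^ 2 / 4 := by
    linear_combination -(hy + hy') / 2
  set w := unboost s ξ y with hw
  have hw' : w = z - (inner ℝ z ξ / ((a + b) * (a + b + M))) • ξ := by rw [hw, unboost]
  have hx : ‖ξ‖ ^ 2 = (a + b) ^ 2 - M ^ 2 := by linarith
  have hτM : a + b + M ≠ 0 := by positivity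
  have hw2 : ‖w‖ ^ 2 = M ^ 2 / 4 - s ^ 2 := by
    rw [hw', @norm_sub_sq_real, norm_smul, mul_pow, Real.norm_eq_abs, sq_abs,
      real_inner_smul_right, hz2, hzξ, hx]
    generalize a + b = τ at *
    field_simp
    ring
  have hwξ : inner ℝ w ξ = (a - b) / 2 * M := by
    rw [hw', inner_sub_left, real_inner_smul_left, real_inner_self_eq_norm_sq, hzξ, hx]
    generalize a + b = τ at *
    field_simp
    ring
  have hwM : invMass s w = M := by
    rw [invMass, phi, hw2, add_sub_cancel, show M ^ 2 / 4 = (M / 2) ^ 2 by ring,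
      Real.sqrt_sq (by positivity)]
    ring
  have hwτ : boostEnergy s ξ w = a + b := by
    rw [boostEnergy, hwM, hx, add_sub_cancel, Real.sqrt_sq hτ.le]
  refine ⟨fun h0 => ?_, ?_⟩
  · rw [h0, norm_zero] at hw2
    nlinarith
  · rw [boost, boostCoeff, hwM, hwτ, hwξ]
    conv_rhs => rw [hyz]
    rw [hw', hzξ, add_assoc]
    congr 1
    have : (a + b) * (a - b) / 2 / ((a + b) * (a + b + M)) = (a - b) / 2 * M / (M * (a + b + M)) := by
      generalize a + b = τ at *
      field_simp
    rw [this]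
    abel

end Boost
-- The image of the weighted measure under the energy-momentum map.
section Pushforward

variable {d : ℕ}

/-- Integration in polar coordinates for functions with values in `[0, ∞]`. -/
lemma lintegral_fun_norm_compl_zero {f : ℝ → ℝ≥0∞} (hf : Measurable f) :
    ∫⁻ x in ({0}ᶜ : Set (Space d)), f ‖x‖ =
      ENNReal.ofReal (sphereArea d) * ∫⁻ r in Set.Ioi (0 : ℝ), ENNReal.ofReal (r ^ (d - 1)) * f r := by
  have hmp := (volume : Measure (Space d)).measurePreserving_homeomorphUnitSphereProd
  have h1 := hmp.lintegral_comp_emb (Homeomorph.measurableEmbedding _)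
    (fun p : Metric.sphere (0 : Space d) 1 × Set.Ioi (0 : ℝ) => f p.2)
  simp only [homeomorphUnitSphereProd_apply_snd_coe] at h1
  rw [← lintegral_subtype_comap (measurableSet_singleton (0 : Space d)).compl, h1,
    lintegral_prod _ (by fun_prop)]
  simp only [lintegral_const]
  rw [mul_comm, finrank_euclideanSpace_fin, Measure.volumeIoiPow,
    lintegral_withDensity_eq_lintegral_mul _ (by fun_prop) (by fun_prop), sphereArea,
    ofReal_measureReal (by finiteness)]
  congr 1
  rw [← lintegral_subtype_comap measurableSet_Ioi]
  rfl

/-- The energy of a system of momentum `ρ` whose two particles have centre of mass momenta of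
length `r`. -/
noncomputable def radialEnergy (s ρ r : ℝ) : ℝ := √(4 * (s ^ 2 + r ^ 2) + ρ ^ 2)

lemma boostEnergy_eq_radialEnergy (s : ℝ) (ξ w : Space d) :
    boostEnergy s ξ w = radialEnergy s ‖ξ‖ ‖w‖ := by
  rw [boostEnergy, invMass_sq, radialEnergy]

/-- Substitution τ = `radialEnergy s ρ r`, for which dτ = (4r/τ) dr. -/
lemma lintegral_radialEnergy (s ρ : ℝ) (h : ℝ → ℝ≥0∞) :
    ∫⁻ r in Set.Ioi (0 : ℝ), ENNReal.ofReal (4 * r / radialEnergy s ρ r) * h (radialEnergy s ρ r) =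
      ∫⁻ τ in Set.Ioi √(4 * s ^ 2 + ρ ^ 2), h τ := by
  have hpos (r : ℝ) (hr : 0 < r) : 0 < 4 * (s ^ 2 + r ^ 2) + ρ ^ 2 := by positivity
  have himg : radialEnergy s ρ '' Set.Ioi 0 = Set.Ioi √(4 * s ^ 2 + ρ ^ 2) := by
    ext τ
    constructor
    · rintro ⟨r, hr, rfl⟩
      rw [Set.mem_Ioi] at hr
      exact Real.sqrt_lt_sqrt (by positivity) (by nlinarith)
    · intro hτ
      have h0 : 0 ≤ τ := (Real.sqrt_nonneg _).trans (le_of_lt hτ)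
      have h1 : 4 * s ^ 2 + ρ ^ 2 < τ ^ 2 := (Real.sqrt_lt' ((Real.sqrt_nonneg _).trans_lt hτ)).1 hτ
      refine ⟨√((τ ^ 2 - 4 * s ^ 2 - ρ ^ 2) / 4), Real.sqrt_pos.2 (by linarith), ?_⟩
      rw [radialEnergy, Real.sq_sqrt (by linarith), show 4 * (s ^ 2 + (τ ^ 2 - 4 * s ^ 2 - ρ ^ 2) / 4)
        + ρ ^ 2 = τ ^ 2 by ring, Real.sqrt_sq h0]
  rw [← himg, lintegral_image_eq_lintegral_abs_deriv_mul
    (f' := fun r => 4 * r / radialEnergy s ρ r) measurableSet_Ioi]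
  · refine setLIntegral_congr_fun measurableSet_Ioi fun r hr => ?_
    rw [Set.mem_Ioi] at hr
    have h0 : 0 ≤ radialEnergy s ρ r := Real.sqrt_nonneg _
    rw [abs_of_nonneg (by positivity)]
  · intro r hr
    have h1 : HasDerivAt (fun r : ℝ => 4 * (s ^ 2 + r ^ 2) + ρ ^ 2) (4 * (2 * r)) r := by
      simpa using (((hasDerivAt_pow 2 r).const_add (s ^ 2)).const_mul 4).add_const (ρ ^ 2)
    refine ((h1.sqrt (hpos r hr).ne').congr_deriv ?_).hasDerivWithinAt
    rw [radialEnergy]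
    field_simp
  · intro r hr r' hr' h
    rw [Set.mem_Ioi] at hr hr'
    rw [radialEnergy, radialEnergy, Real.sqrt_inj (hpos r hr).le (hpos r' hr').le] at h
    exact (pow_left_inj₀ hr.le hr'.le two_ne_zero).1 (by linarith)

lemma kernel_eq (s : ℝ) (y₁ y₂ : Space d) : kernel s y₁ y₂ =
    (minkowski s y₁ y₂ - s ^ 2) ^ (((d : ℝ) - 2) / 2) /
      (minkowski s y₁ y₂ + s ^ 2) ^ ((1 : ℝ) / 2) := rfl

/-- The density `1 / (φ_s(|y₁|) φ_s(|y₂|) K_s(y₁, y₂))`. -/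
noncomputable def invWeight (s : ℝ) (y : Space d × Space d) : ℝ :=
  (phi s ‖y.1‖ * phi s ‖y.2‖ * kernel s y.1 y.2)⁻¹

lemma sphereArea_nonneg (d : ℕ) : 0 ≤ sphereArea d := measureReal_nonneg

/-- The constant `2^{-(d-1)/2} |𝕊^{d-1}|`. -/
noncomputable def pushConst (d : ℕ) : ℝ := (2 : ℝ) ^ (-(((d : ℝ) - 1) / 2)) * sphereArea d

/-- The angle between w and ξ enters the Jacobian and the product of the two energies through the
same factor D = τ²M² - 4(w·ξ)², which cancels. The kernel involves |w| alone, so the result is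
radial in w. -/
lemma abs_det_mul_invWeight (hd : 1 ≤ d) {s : ℝ} (ξ : Space d) {w : Space d} (hw : w ≠ 0) :
    |boostEnergy s ξ w / invMass s w -
        4 * inner ℝ w ξ ^ 2 / (boostEnergy s ξ w * invMass s w ^ 3)| *
      invWeight s (boost s ξ w, ξ - boost s ξ w) =
    (2 : ℝ) ^ (-(((d : ℝ) - 1) / 2)) * (4 * ‖w‖ / radialEnergy s ‖ξ‖ ‖w‖) / ‖w‖ ^ (d - 1) := by
  have hr : 0 < ‖w‖ := norm_pos_iff.2 hw
  have hM := invMass_pos (s := s) hw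
  have hτ := boostEnergy_pos (s := s) ξ hw
  have hM2 := invMass_sq s w
  have hτ2 := boostEnergy_sq s ξ w
  rw [← boostEnergy_eq_radialEnergy, invWeight]
  simp only
  rw [kernel_eq, minkowski_boost ξ hw, phi_boost ξ hw, phi_sub_boost ξ hw, add_sub_cancel_right,
    show 2 * ‖w‖ ^ 2 + s ^ 2 + s ^ 2 = invMass s w ^ 2 / 2 by rw [hM2]; ring]
  have hq : inner ℝ w ξ ^ 2 ≤ ‖w‖ ^ 2 * ‖ξ‖ ^ 2 := by
    rw [← mul_pow, ← sq_abs]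
    exact pow_le_pow_left₀ (abs_nonneg _) (abs_real_inner_le_norm w ξ) 2
  have hD : 0 < boostEnergy s ξ w ^ 2 * invMass s w ^ 2 - 4 * inner ℝ w ξ ^ 2 := by
    have h1 : 4 * ‖w‖ ^ 2 ≤ invMass s w ^ 2 := by rw [hM2]; nlinarith [sq_nonneg s]
    have h2 : 4 * (‖w‖ ^ 2 * ‖ξ‖ ^ 2) ≤ invMass s w ^ 2 * ‖ξ‖ ^ 2 := by
      rw [← mul_assoc]; gcongr
    have h3 : 0 < invMass s w ^ 2 * invMass s w ^ 2 := by positivity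
    rw [hτ2]
    linarith [add_mul (invMass s w ^ 2) (‖ξ‖ ^ 2) (invMass s w ^ 2),
      mul_comm (invMass s w ^ 2) (‖ξ‖ ^ 2)]
  have hdet : boostEnergy s ξ w / invMass s w -
      4 * inner ℝ w ξ ^ 2 / (boostEnergy s ξ w * invMass s w ^ 3) =
      (boostEnergy s ξ w ^ 2 * invMass s w ^ 2 - 4 * inner ℝ w ξ ^ 2) /
        (boostEnergy s ξ w * invMass s w ^ 3) := by
    field_simp
  have hphi : (boostEnergy s ξ w / 2 + inner ℝ w ξ / invMass s w) *
      (boostEnergy s ξ w / 2 - inner ℝ w ξ / invMass s w) =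
      (boostEnergy s ξ w ^ 2 * invMass s w ^ 2 - 4 * inner ℝ w ξ ^ 2) / (4 * invMass s w ^ 2) := by
    field_simp
    ring
  have hK1 : (2 * ‖w‖ ^ 2) ^ (((d : ℝ) - 2) / 2) =
      (2 : ℝ) ^ (((d : ℝ) - 1) / 2) * ‖w‖ ^ (d - 1) / (√2 * ‖w‖) := by
    rw [Real.mul_rpow two_pos.le (by positivity), ← Real.rpow_natCast ‖w‖ 2, ← Real.rpow_mul hr.le,
      ← Real.rpow_natCast ‖w‖ (d - 1), Real.sqrt_eq_rpow, Nat.cast_sub hd,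
      show ((d : ℝ) - 2) / 2 = ((d : ℝ) - 1) / 2 - 1 / 2 by ring,
      Real.rpow_sub two_pos, show ((2 : ℕ) : ℝ) * (((d : ℝ) - 1) / 2 - 1 / 2) =
        ((d : ℝ) - ((1 : ℕ) : ℝ)) - 1 by push_cast; ring, Real.rpow_sub_one hr.ne']
    field_simp
  have hK2 : (invMass s w ^ 2 / 2) ^ ((1 : ℝ) / 2) = invMass s w / √2 := by
    rw [← Real.sqrt_eq_rpow, Real.sqrt_div (sq_nonneg _), Real.sqrt_sq hM.le]
  rw [hdet, hphi, abs_of_pos (by positivity), hK1, hK2, Real.rpow_neg two_pos.le]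
  generalize boostEnergy s ξ w ^ 2 * invMass s w ^ 2 - 4 * inner ℝ w ξ ^ 2 = D at *
  generalize (2 : ℝ) ^ (((d : ℝ) - 1) / 2) = a at *
  field_simp

/-- The pairs of momenta which are not parallel in space-time. -/
def nonparallel (d : ℕ) (s : ℝ) : Set (Space d × Space d) := {y | s ^ 2 < minkowski s y.1 y.2}

/-- The image of the energy-momentum map. -/
def massCone (d : ℕ) (s : ℝ) : Set (ℝ × Space d) := {z | √(4 * s ^ 2 + ‖z.2‖ ^ 2) < z.1}

lemma continuous_minkowski (s : ℝ) :
    Continuous fun y : Space d × Space d => minkowski s y.1 y.2 := by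
  have := continuous_phi s
  unfold minkowski; fun_prop

lemma isOpen_nonparallel (d : ℕ) (s : ℝ) : IsOpen (nonparallel d s) :=
  isOpen_lt continuous_const (continuous_minkowski s)

lemma measurableSet_nonparallel (d : ℕ) (s : ℝ) : MeasurableSet (nonparallel d s) :=
  (isOpen_nonparallel d s).measurableSet

lemma measurableSet_massCone (d : ℕ) (s : ℝ) : MeasurableSet (massCone d s) :=
  (isOpen_lt (by fun_prop) (by fun_prop)).measurableSet

lemma measurable_kernel (s : ℝ) : Measurable fun y : Space d × Space d => kernel s y.1 y.2 := by
  have := (continuous_minkowski (d := d) s).measurable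
  simp only [kernel_eq]
  fun_prop

lemma measurable_invWeight (s : ℝ) : Measurable (invWeight s : Space d × Space d → ℝ) := by
  have h1 := measurable_kernel (d := d) s
  have h2 := (continuous_phi s).measurable
  unfold invWeight
  fun_prop

lemma measurable_radialEnergy (s ρ : ℝ) : Measurable (radialEnergy s ρ) := by
  unfold radialEnergy; fun_prop

lemma image_boost (s : ℝ) (ξ : Space d) :
    boost s ξ '' {0}ᶜ = {y | s ^ 2 < minkowski s y (ξ - y)} := by
  ext y
  constructor
  · rintro ⟨w, hw, rfl⟩
    rw [Set.mem_ofPred_eq, minkowski_boost ξ hw]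
    have : 0 < ‖w‖ := norm_pos_iff.2 hw
    nlinarith
  · intro hy
    exact ⟨unboost s ξ y, (boost_unboost hy).1, (boost_unboost hy).2⟩

/-- Integration over the pairs of momenta with a given sum. -/
lemma lintegral_fiber (hd : 1 ≤ d) (s : ℝ) (ξ : Space d) {h : ℝ → ℝ≥0∞} (hh : Measurable h) :
    ∫⁻ y in {y | s ^ 2 < minkowski s y (ξ - y)},
      ENNReal.ofReal (invWeight s (y, ξ - y)) * h (phi s ‖y‖ + phi s ‖ξ - y‖) =
    ENNReal.ofReal (pushConst d) * ∫⁻ τ in Set.Ioi √(4 * s ^ 2 + ‖ξ‖ ^ 2), h τ := by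
  have hinj : Set.InjOn (boost s ξ) {0}ᶜ := fun w hw w' hw' h => by
    rw [← unboost_boost (s := s) ξ hw, h, unboost_boost ξ hw']
  choose! T' hT hdet using fun (w : Space d) (hw : w ≠ 0) => hasFDerivAt_boost (s := s) ξ hw
  rw [← image_boost, lintegral_image_eq_lintegral_abs_det_fderiv_mul volume
    (measurableSet_singleton 0).compl (fun w hw => (hT w hw).hasFDerivWithinAt) hinj]
  -- The integrand as a function of r = |w|. Its r^{-(d-1)} cancels the polar Jacobian and leaves
  -- exactly dτ = (4r/τ) dr.
  set f : ℝ → ℝ≥0∞ := fun r => ENNReal.ofReal ((2 : ℝ) ^ (-(((d : ℝ) - 1) / 2)) *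
    (4 * r / radialEnergy s ‖ξ‖ r) / r ^ (d - 1)) * h (radialEnergy s ‖ξ‖ r) with hf
  have hfm : Measurable f := by
    have := measurable_radialEnergy s ‖ξ‖
    fun_prop
  calc _ = ∫⁻ w in ({0}ᶜ : Set (Space d)), f ‖w‖ := by
        refine setLIntegral_congr_fun (measurableSet_singleton 0).compl fun w hw => ?_
        simp only [hf]
        rw [← mul_assoc, ← ENNReal.ofReal_mul (abs_nonneg _), hdet w hw,
          abs_det_mul_invWeight hd ξ hw, phi_boost ξ hw, phi_sub_boost ξ hw,
          add_add_sub_cancel, add_halves, boostEnergy_eq_radialEnergy]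
    _ = _ := by
        rw [lintegral_fun_norm_compl_zero hfm, pushConst, mul_comm (2 ^ _ : ℝ),
          ENNReal.ofReal_mul (sphereArea_nonneg d), mul_assoc, ← lintegral_radialEnergy]
        congr 1
        rw [← lintegral_const_mul' _ _ ENNReal.ofReal_ne_top]
        refine setLIntegral_congr_fun measurableSet_Ioi fun r hr => ?_
        have hr' : (0 : ℝ) < r := hr
        simp only [hf]
        rw [← mul_assoc, ← mul_assoc, ← ENNReal.ofReal_mul (by positivity),
          ← ENNReal.ofReal_mul (by positivity)]
        congr 2
        field_simp

/-- The measure `dy₁ dy₂ / (φ_s(|y₁|) φ_s(|y₂|) K_s(y₁, y₂))` on pairs of momenta. -/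
noncomputable def pairMeasure (d : ℕ) (s : ℝ) : Measure (Space d × Space d) :=
  (volume.restrict (nonparallel d s)).withDensity fun y => ENNReal.ofReal (invWeight s y)

lemma lintegral_pairMeasure (s : ℝ) {F : Space d × Space d → ℝ≥0∞} (hF : Measurable F) :
    ∫⁻ y, F y ∂(pairMeasure d s) =
      ∫⁻ y in nonparallel d s, ENNReal.ofReal (invWeight s y) * F y :=
  lintegral_withDensity_eq_lintegral_mul _ (measurable_invWeight s).ennreal_ofReal hF

/-- The shear (y₁, y₂) ↦ (y₁, y₁ + y₂) preserves Lebesgue measure. -/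
lemma lintegral_nonparallel (s : ℝ) {F : Space d × Space d → ℝ≥0∞} (hF : Measurable F) :
    ∫⁻ y in nonparallel d s, F y =
      ∫⁻ ξ : Space d, ∫⁻ y in {y | s ^ 2 < minkowski s y (ξ - y)}, F (y, ξ - y) := by
  have hG := hF.indicator (measurableSet_nonparallel d s)
  have hmp := measurePreserving_prod_add (volume : Measure (Space d)) (volume : Measure (Space d))
  have hsub : Measurable fun p : Space d × Space d => (p.1, p.2 - p.1) := by fun_prop
  have hGs : Measurable fun p : Space d × Space d =>
      (nonparallel d s).indicator F (p.1, p.2 - p.1) := hG.comp hsub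
  have h1 := hmp.lintegral_comp hGs
  simp only [add_sub_cancel_left] at h1
  rw [← lintegral_indicator (measurableSet_nonparallel d s), Measure.volume_eq_prod, h1,
    lintegral_prod_symm _ hGs.aemeasurable]
  refine lintegral_congr fun ξ => ?_
  have hc : Continuous fun y : Space d => minkowski s y (ξ - y) := by
    have := continuous_phi s
    unfold minkowski; fun_prop
  have hms : MeasurableSet {y : Space d | s ^ 2 < minkowski s y (ξ - y)} :=
    measurableSet_lt measurable_const hc.measurable
  rw [← lintegral_indicator hms]
  refine lintegral_congr fun y => ?_
  by_cases hy : s ^ 2 < minkowski s y (ξ - y)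
  · exact (Set.indicator_of_mem (show (y, ξ - y) ∈ nonparallel d s from hy) F).trans
      (Set.indicator_of_mem (s := {y | s ^ 2 < minkowski s y (ξ - y)}) hy
        fun y => F (y, ξ - y)).symm
  · exact (Set.indicator_of_notMem (show (y, ξ - y) ∉ nonparallel d s from hy) F).trans
      (Set.indicator_of_notMem (s := {y | s ^ 2 < minkowski s y (ξ - y)}) hy
        fun y => F (y, ξ - y)).symm

/-- The image of `pairMeasure` under the energy-momentum map is a multiple of Lebesgue measure. -/
theorem map_pairMeasure (hd : 1 ≤ d) (s : ℝ) :
    (pairMeasure d s).map (energyMomentum s) =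
      ENNReal.ofReal (pushConst d) • volume.restrict (massCone d s) := by
  have hem : Measurable (energyMomentum s : Space d × Space d → _) :=
    (continuous_energyMomentum s).measurable
  refine Measure.ext_of_lintegral _ fun F hF => ?_
  rw [lintegral_map hF hem, lintegral_pairMeasure s (F := fun y => F (energyMomentum s y)) (hF.comp hem),
    lintegral_smul_measure]
  rw [lintegral_nonparallel s (by have := measurable_invWeight (d := d) s; fun_prop),
    ← lintegral_indicator (measurableSet_massCone d s), Measure.volume_eq_prod,
    lintegral_prod_symm _ (hF.indicator (measurableSet_massCone d s)).aemeasurable,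
    smul_eq_mul, ← lintegral_const_mul' _ _ ENNReal.ofReal_ne_top]
  refine lintegral_congr fun ξ => ?_
  have h2 := lintegral_fiber hd s ξ (h := fun τ => F (τ, ξ)) (by fun_prop)
  rw [← lintegral_indicator measurableSet_Ioi] at h2
  simp only [energyMomentum, add_sub_cancel]
  exact h2

end Pushforward
-- The bilinear inequality and the criterion for equality.
section Estimate

variable {d : ℕ}

/-- The weight `φ_s(|y₁|) φ_s(|y₂|) K_s(y₁, y₂)`. -/
noncomputable def weight (s : ℝ) (y : Space d × Space d) : ℝ :=
  phi s ‖y.1‖ * phi s ‖y.2‖ * kernel s y.1 y.2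

lemma invWeight_eq (s : ℝ) (y : Space d × Space d) : invWeight s y = (weight s y)⁻¹ := rfl

lemma measurable_weight (s : ℝ) : Measurable (weight s : Space d × Space d → ℝ) := by
  have h1 := measurable_kernel (d := d) s
  have h2 := (continuous_phi s).measurable
  unfold weight
  fun_prop

lemma phi_mul_phi_pos {s : ℝ} {y : Space d × Space d} (hy : y ∈ nonparallel d s) :
    0 < phi s ‖y.1‖ ∧ 0 < phi s ‖y.2‖ := by
  have h : s ^ 2 < minkowski s y.1 y.2 := hy
  have h0 := phi_nonneg s ‖y.1‖
  have h1 := phi_nonneg s ‖y.2‖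
  rw [minkowski] at h
  constructor
  · refine lt_of_le_of_ne h0 fun h2 => ?_
    have : ‖y.1‖ = 0 := le_antisymm (h2 ▸ le_phi s ‖y.1‖) (norm_nonneg _)
    rw [← h2, norm_eq_zero.1 this, inner_zero_left, zero_mul] at h
    nlinarith
  · refine lt_of_le_of_ne h1 fun h2 => ?_
    have : ‖y.2‖ = 0 := le_antisymm (h2 ▸ le_phi s ‖y.2‖) (norm_nonneg _)
    rw [← h2, norm_eq_zero.1 this, inner_zero_right, mul_zero] at h
    nlinarith

lemma kernel_pos {s : ℝ} {y : Space d × Space d} (hy : y ∈ nonparallel d s) :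
    0 < kernel s y.1 y.2 := by
  have h : s ^ 2 < minkowski s y.1 y.2 := hy
  rw [kernel_eq]
  have h1 : 0 < minkowski s y.1 y.2 - s ^ 2 := by linarith
  have h2 : 0 < minkowski s y.1 y.2 + s ^ 2 := by nlinarith
  positivity

lemma weight_pos {s : ℝ} {y : Space d × Space d} (hy : y ∈ nonparallel d s) : 0 < weight s y := by
  obtain ⟨h1, h2⟩ := phi_mul_phi_pos hy
  have := kernel_pos hy
  rw [weight]
  positivity

lemma sphereArea_pos (hd : 1 ≤ d) : 0 < sphereArea d := by
  rw [sphereArea, Measure.toSphere_real_apply_univ, finrank_euclideanSpace_fin]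
  refine mul_pos (by exact_mod_cast hd) ?_
  exact ENNReal.toReal_pos (Metric.measure_ball_pos _ _ one_pos).ne' measure_ball_lt_top.ne

lemma pushConst_pos (hd : 1 ≤ d) : 0 < pushConst d :=
  mul_pos (by positivity) (sphereArea_pos hd)

/-- The three sources of the constant: the squared normalisation (2π)^{-2d} of two propagations,
Plancherel on ℝ^{d+1}, and the pushforward. -/
lemma KG_eq (d : ℕ) :
    KG d = (((2 * Real.pi) ^ (2 * d))⁻¹ ^ 2 * (2 * Real.pi) ^ (d + 1)) * pushConst d := by
  have hpi : 0 < 2 * Real.pi := by positivity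
  rw [KG, pushConst, Real.rpow_sub hpi, Real.rpow_one,
    show 3 * (d : ℝ) = ((3 * d : ℕ) : ℝ) by push_cast; ring, Real.rpow_natCast]
  field_simp
  ring

lemma KG_pos (hd : 1 ≤ d) : 0 < KG d := by
  rw [KG_eq]
  have := pushConst_pos hd
  positivity

lemma lintegral_energyMomentum (hd : 1 ≤ d) (s : ℝ) {F : ℝ × Space d → ℝ≥0∞} (hF : Measurable F) :
    ∫⁻ y in nonparallel d s, ENNReal.ofReal (invWeight s y) * F (energyMomentum s y) =
      ENNReal.ofReal (pushConst d) * ∫⁻ z in massCone d s, F z := by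
  have hem : Measurable (energyMomentum s : Space d × Space d → _) :=
    (continuous_energyMomentum s).measurable
  rw [← smul_eq_mul, ← lintegral_smul_measure, ← map_pairMeasure hd, lintegral_map hF hem,
    lintegral_pairMeasure s (F := fun y => F (energyMomentum s y)) (hF.comp hem)]

lemma integral_energyMomentum (hd : 1 ≤ d) (s : ℝ) {F : ℝ × Space d → ℂ} (hF : Measurable F) :
    ∫ y in nonparallel d s, (invWeight s y : ℂ) * F (energyMomentum s y) =
      (pushConst d : ℂ) * ∫ z in massCone d s, F z := by
  have hem : Measurable (energyMomentum s : Space d × Space d → _) :=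
    (continuous_energyMomentum s).measurable
  have h1 := integral_map (μ := pairMeasure d s) hem.aemeasurable (f := F)
    hF.aestronglyMeasurable
  rw [map_pairMeasure hd, integral_smul_measure, ENNReal.toReal_ofReal (pushConst_pos hd).le,
    pairMeasure, integral_withDensity_eq_integral_toReal_smul
      (measurable_invWeight s).ennreal_ofReal (by simp)] at h1
  rw [← Complex.real_smul, h1]
  refine setIntegral_congr_fun (measurableSet_nonparallel d s) fun y hy => ?_
  have : 0 ≤ invWeight s y := (inv_pos.2 (weight_pos hy)).le
  simp only [ENNReal.toReal_ofReal this, Complex.real_smul]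

lemma integrableOn_massCone (hd : 1 ≤ d) (s : ℝ) {F : ℝ × Space d → ℂ} (hF : Measurable F)
    (h : IntegrableOn (fun y => (invWeight s y : ℂ) * F (energyMomentum s y)) (nonparallel d s)) :
    IntegrableOn F (massCone d s) := by
  refine ⟨hF.aestronglyMeasurable, ?_⟩
  have h1 := lintegral_energyMomentum hd s (F := fun z => ‖F z‖ₑ) hF.enorm
  have h2 : ∫⁻ y in nonparallel d s, ENNReal.ofReal (invWeight s y) * ‖F (energyMomentum s y)‖ₑ
      < ⊤ := by
    refine (setLIntegral_congr_fun (measurableSet_nonparallel d s) fun y hy => ?_).trans_lt h.2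
    have : 0 ≤ invWeight s y := (inv_pos.2 (weight_pos hy)).le
    simp only [enorm_mul]
    rw [← ofReal_norm (invWeight s y : ℂ), Complex.norm_real, Real.norm_of_nonneg this]
  rw [h1] at h2
  exact (ENNReal.mul_lt_top_iff.1 h2).elim (fun h => h.2) fun h => h.elim
    (fun h => absurd h (by simpa using pushConst_pos hd)) fun h => by
      rw [HasFiniteIntegral, h]; exact ENNReal.zero_lt_top

lemma productNormSq_eq_lintegral (u₁ u₂ : ℝ × Space d → ℂ) :
    productNormSq u₁ u₂ = ∫⁻ v : SpaceTime d, ‖u₁ v.ofLp * u₂ v.ofLp‖ₑ ^ 2 := by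
  rw [productNormSq, eLpNorm_two_sq, lintegral_spaceTime]

lemma IsPropagation.tempered_mul {s : ℝ} {f₁ f₂ F₁ F₂ : Space d → ℂ}
    {u₁ u₂ : ℝ × Space d → ℂ} (h₁ : IsPropagation s f₁ F₁ u₁) (h₂ : IsPropagation s f₂ F₂ u₂) :
    Tempered fun v : SpaceTime d => u₁ v.ofLp * u₂ v.ofLp :=
  fun χ => integrable_spaceTime.2 (h₁.integral_mul_test h₂ χ).1

lemma IsPropagation.integral_spaceTime_mul {s : ℝ} {f₁ f₂ F₁ F₂ : Space d → ℂ}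
    {u₁ u₂ : ℝ × Space d → ℂ} (h₁ : IsPropagation s f₁ F₁ u₁) (h₂ : IsPropagation s f₂ F₂ u₂)
    (χ : 𝓢(SpaceTime d, ℂ)) :
    ∫ v : SpaceTime d, u₁ v.ofLp * u₂ v.ofLp * χ v =
      ((((2 * Real.pi) ^ (2 * d))⁻¹ : ℝ) : ℂ) * ∫ y : Space d × Space d,
        F₁ y.1 * F₂ y.2 * conjFourier χ (WithLp.toLp 2 (energyMomentum s y)) := by
  rw [← (h₁.integral_mul_test h₂ χ).2, integral_spaceTime]

lemma finrank_spaceTime (d : ℕ) : Module.finrank ℝ (SpaceTime d) = d + 1 := by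
  rw [(WithLp.linearEquiv 2 ℝ (ℝ × Space d)).finrank_eq, Module.finrank_prod,
    Module.finrank_self, finrank_euclideanSpace_fin, add_comm]

/-- The `L²` norm of the product when `f̂₁ ⊗ f̂₂` may be replaced by a function which depends on the
energy-momentum vector only, up to the factor `invWeight`. -/
theorem IsPropagation.productNormSq_eq_of_fiberwise (hd : 1 ≤ d) {s : ℝ}
    {f₁ f₂ F₁ F₂ : Space d → ℂ} {u₁ u₂ : ℝ × Space d → ℂ}
    (h₁ : IsPropagation s f₁ F₁ u₁) (h₂ : IsPropagation s f₂ F₂ u₂)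
    {A : Space d × Space d → ℂ} {G : ℝ × Space d → ℂ} {r : ℝ} (hr : 0 < r) (hG : Measurable G)
    (hAG : ∀ y ∈ nonparallel d s, A y = invWeight s y * G (energyMomentum s y))
    (hA0 : ∀ᵐ y, y ∉ nonparallel d s → A y = 0)
    (hA : ∀ X : 𝓢(SpaceTime d, ℂ),
      Integrable (fun y => A y * X (WithLp.toLp 2 (energyMomentum s y))) ∧
      ∫ y : Space d × Space d, F₁ y.1 * F₂ y.2 * X (WithLp.toLp 2 (energyMomentum s y)) =
        r * ∫ y, A y * X (WithLp.toLp 2 (energyMomentum s y))) :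
    productNormSq u₁ u₂ = ENNReal.ofReal (KG d * r ^ 2) *
      ∫⁻ y in nonparallel d s, ‖A y‖ₑ ^ 2 * ENNReal.ofReal (weight s y) := by
  have hc := pushConst_pos hd
  -- The density of the image of `F₁ ⊗ F₂`: by `map_pairMeasure` the image of `A` has density
  -- `pushConst d` times `G` on the cone.
  let H : SpaceTime d → ℂ := fun v => ((r * pushConst d : ℝ) : ℂ) *
    (massCone d s).indicator G v.ofLp
  have hmul (X : 𝓢(SpaceTime d, ℂ)) (z : ℝ × Space d) : H (WithLp.toLp 2 z) * X (WithLp.toLp 2 z) =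
      ((r * pushConst d : ℝ) : ℂ) *
        (massCone d s).indicator (fun z => G z * X (WithLp.toLp 2 z)) z := by
    rw [Set.indicator_mul_left, ← mul_assoc]
  have hGX (X : 𝓢(SpaceTime d, ℂ)) : Measurable fun z => G z * X (WithLp.toLp 2 z) :=
    hG.mul (continuous_test X).measurable
  have hAX (X : 𝓢(SpaceTime d, ℂ)) (y) (hy : y ∈ nonparallel d s) :
      A y * X (WithLp.toLp 2 (energyMomentum s y)) = invWeight s y *
        (fun z => G z * X (WithLp.toLp 2 z)) (energyMomentum s y) := by
    rw [hAG y hy, mul_assoc]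
  have hH : Tempered H := fun X => by
    rw [integrable_spaceTime]
    simp only [hmul]
    refine Integrable.const_mul ?_ _
    rw [integrable_indicator_iff (measurableSet_massCone d s)]
    refine integrableOn_massCone hd s (hGX X) ?_
    exact ((hA X).1.integrableOn).congr_fun (hAX X) (measurableSet_nonparallel d s)
  have hpair (X : 𝓢(SpaceTime d, ℂ)) :
      ∫ y : Space d × Space d, F₁ y.1 * F₂ y.2 * X (WithLp.toLp 2 (energyMomentum s y)) =
        ∫ v, H v * X v := by
    rw [integral_spaceTime]
    simp only [hmul]
    rw [integral_const_mul, integral_indicator (measurableSet_massCone d s), (hA X).2]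
    push_cast
    rw [mul_assoc, ← integral_energyMomentum hd s (hGX X),
      ← setIntegral_congr_fun (measurableSet_nonparallel d s) (hAX X),
      setIntegral_eq_integral_of_ae_compl_eq_zero]
    filter_upwards [hA0] with y hy hy'
    rw [hy hy', zero_mul]
  have hmain := lintegral_sq_eq_of_conjFourier (h₁.tempered_mul h₂) hH
    (((2 * Real.pi) ^ (2 * d))⁻¹) (by positivity) fun χ => by
      obtain ⟨X, hX⟩ := exists_schwartz_conjFourier χ
      rw [h₁.integral_spaceTime_mul h₂]
      simp_rw [← hX]
      rw [hpair]
  -- Since `A` is the inverse weight times `G`, |A|² times the weight is the inverse weight times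
  -- |G|², to which the pushforward applies without loss.
  have hsq : ∫⁻ y in nonparallel d s, ‖A y‖ₑ ^ 2 * ENNReal.ofReal (weight s y) =
      ENNReal.ofReal (pushConst d) * ∫⁻ z in massCone d s, ‖G z‖ₑ ^ 2 := by
    rw [← lintegral_energyMomentum hd s (hG.enorm.pow_const 2)]
    refine setLIntegral_congr_fun (measurableSet_nonparallel d s) fun y hy => ?_
    have hw := weight_pos hy
    have hi : 0 ≤ invWeight s y := (inv_pos.2 hw).le
    rw [hAG y hy, enorm_mul, mul_pow, ← ofReal_norm (invWeight s y : ℂ), Complex.norm_real,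
      Real.norm_of_nonneg hi, ← ENNReal.ofReal_pow hi, mul_right_comm,
      ← ENNReal.ofReal_mul (by positivity)]
    congr 2
    rw [invWeight_eq]
    field_simp
  have hHn : ∫⁻ v, ‖H v‖ₑ ^ 2 = ENNReal.ofReal ((r * pushConst d) ^ 2) *
      ∫⁻ z in massCone d s, ‖G z‖ₑ ^ 2 := by
    rw [lintegral_spaceTime, ← lintegral_indicator (measurableSet_massCone d s),
      ← lintegral_const_mul' _ _ ENNReal.ofReal_ne_top]
    refine lintegral_congr fun z => ?_
    simp only [H]
    rw [enorm_mul, mul_pow, ← ofReal_norm ((r * pushConst d : ℝ) : ℂ), Complex.norm_real,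
      Real.norm_of_nonneg (by positivity), ← ENNReal.ofReal_pow (by positivity)]
    congr 1
    by_cases hz : z ∈ massCone d s <;> simp [hz]
  rw [productNormSq_eq_lintegral, hmain, hHn, hsq, finrank_spaceTime, KG_eq, ← mul_assoc,
    ← mul_assoc, ← ENNReal.ofReal_mul (by positivity), ← ENNReal.ofReal_mul (by positivity)]
  congr 2
  ring

lemma weightedIntegral_eq (s : ℝ) (F₁ F₂ : Space d → ℂ) : weightedIntegral s F₁ F₂ =
    ∫⁻ y : Space d × Space d, ‖F₁ y.1 * F₂ y.2‖ₑ ^ 2 * ENNReal.ofReal (weight s y) := by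
  refine lintegral_congr fun y => ?_
  rw [← ofReal_norm, ← ENNReal.ofReal_pow (norm_nonneg _), ← ENNReal.ofReal_mul (by positivity),
    norm_mul, mul_pow, weight]
  congr 1
  ring

/-- Since φ_s(|y₁|) φ_s(|y₂|) ≥ s² + |y₁||y₂|, failure of the strict inequality forces equality in
y₁·y₂ ≤ |y₁||y₂|. -/
lemma mem_span_of_notMem_nonparallel {s : ℝ} {y₁ y₂ : Space d} (h₁ : y₁ ≠ 0)
    (h : (y₁, y₂) ∉ nonparallel d s) : y₂ ∈ Submodule.span ℝ {y₁} := by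
  have h2 : minkowski s y₁ y₂ ≤ s ^ 2 := not_lt.1 h
  have h3 : s ^ 2 + ‖y₁‖ * ‖y₂‖ ≤ phi s ‖y₁‖ * phi s ‖y₂‖ := by
    rw [phi, phi, ← Real.sqrt_mul (by positivity)]
    refine Real.le_sqrt_of_sq_le ?_
    nlinarith [mul_nonneg (sq_nonneg s) (sq_nonneg (‖y₁‖ - ‖y₂‖))]
  rw [minkowski] at h2
  have h4 : inner ℝ y₁ y₂ = ‖y₁‖ * ‖y₂‖ :=
    le_antisymm (real_inner_le_norm _ _) (by linarith)
  rw [inner_eq_norm_mul_iff_real] at h4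
  have h5 : ‖y₁‖ ≠ 0 := norm_ne_zero_iff.2 h₁
  rw [Submodule.mem_span_singleton]
  refine ⟨‖y₁‖⁻¹ * ‖y₂‖, ?_⟩
  rw [mul_smul, h4, smul_smul, inv_mul_cancel₀ h5, one_smul]

/-- For each y₁ ≠ 0 the exceptional y₂ lie on a line, which is a null set when d ≥ 2. -/
lemma ae_mem_nonparallel (hd : 2 ≤ d) (s : ℝ) : ∀ᵐ y, y ∈ nonparallel d s := by
  have : Nontrivial (Space d) := Module.nontrivial_of_finrank_pos (R := ℝ)
    (by rw [finrank_euclideanSpace_fin]; omega)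
  change volume (nonparallel d s)ᶜ = 0
  rw [Measure.volume_eq_prod, Measure.measure_prod_null (measurableSet_nonparallel d s).compl]
  have h0 : ∀ᵐ y : Space d, y ≠ 0 := by
    simp [ae_iff]
  filter_upwards [h0] with y hy
  refine measure_mono_null (t := (Submodule.span ℝ {y} : Set (Space d)))
    (fun y₂ h => mem_span_of_notMem_nonparallel hy h) (Measure.addHaar_submodule _ _ fun h => ?_)
  have h1 := finrank_span_singleton (K := ℝ) hy
  rw [h, finrank_top, finrank_euclideanSpace_fin] at h1
  omega

/-- The bilinear estimate. -/
theorem IsPropagation.productNormSq_le (hd : 2 ≤ d) {s : ℝ}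
    {f₁ f₂ F₁ F₂ : Space d → ℂ} {u₁ u₂ : ℝ × Space d → ℂ}
    (h₁ : IsPropagation s f₁ F₁ u₁) (h₂ : IsPropagation s f₂ F₂ u₂) :
    productNormSq u₁ u₂ ≤ ENNReal.ofReal (KG d) * weightedIntegral s F₁ F₂ := by
  have hF : AEStronglyMeasurable (fun y : Space d × Space d => F₁ y.1 * F₂ y.2) volume := by
    obtain ⟨g₁, k₁, hg₁, hk₁, rfl⟩ := h₁.memL1AddL2
    obtain ⟨g₂, k₂, hg₂, hk₂, rfl⟩ := h₂.memL1AddL2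
    exact aestronglyMeasurable_prod_mul (hg₁.1.add hk₁.1) (hg₂.1.add hk₂.1)
  rw [productNormSq_eq_lintegral]
  refine (h₁.tempered_mul h₂).lintegral_sq_le _ fun χ => ?_
  obtain ⟨X, hX⟩ := exists_schwartz_conjFourier χ
  have hXm : Measurable fun z : ℝ × Space d => ‖X (WithLp.toLp 2 z)‖ₑ :=
    (continuous_test X).measurable.enorm
  have hXe : Measurable fun y : Space d × Space d => ‖X (WithLp.toLp 2 (energyMomentum s y))‖ₑ :=
    hXm.comp (continuous_energyMomentum s).measurable
  have hw := measurable_weight (d := d) s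
  have hi := measurable_invWeight (d := d) s
  have hae := ae_mem_nonparallel hd s
  -- Cauchy–Schwarz after inserting √weight · √invWeight = 1. The factor with `X` depends on energy
  -- and momentum only, so the pushforward evaluates it; enlarging the cone to all of space-time
  -- gives the L² norm of `X`.
  have hCS : ‖∫ y : Space d × Space d, F₁ y.1 * F₂ y.2 *
      X (WithLp.toLp 2 (energyMomentum s y))‖ₑ ^ 2 ≤ weightedIntegral s F₁ F₂ *
      (ENNReal.ofReal (pushConst d) * ∫⁻ v, ‖X v‖ₑ ^ 2) := by
    have hA : ∫⁻ y : Space d × Space d,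
        (‖F₁ y.1 * F₂ y.2‖ₑ * ENNReal.ofReal √(weight s y)) ^ 2 = weightedIntegral s F₁ F₂ := by
      rw [weightedIntegral_eq]
      refine lintegral_congr_ae ?_
      filter_upwards [hae] with y hy
      rw [mul_pow, ← ENNReal.ofReal_pow (Real.sqrt_nonneg _), Real.sq_sqrt (weight_pos hy).le]
    have hB : ∫⁻ y, (ENNReal.ofReal √(invWeight s y) *
        ‖X (WithLp.toLp 2 (energyMomentum s y))‖ₑ) ^ 2 ≤
        ENNReal.ofReal (pushConst d) * ∫⁻ v, ‖X v‖ₑ ^ 2 := by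
      rw [lintegral_spaceTime]
      have h3 := lintegral_energyMomentum (by omega : 1 ≤ d) s (hXm.pow_const 2)
      calc _ = ∫⁻ y in nonparallel d s, ENNReal.ofReal (invWeight s y) *
            ‖X (WithLp.toLp 2 (energyMomentum s y))‖ₑ ^ 2 := by
            rw [← setLIntegral_univ, setLIntegral_congr (Filter.eventuallyEq_univ.2 hae).symm]
            refine setLIntegral_congr_fun (measurableSet_nonparallel d s) fun y hy => ?_
            have h4 : 0 ≤ invWeight s y := (inv_pos.2 (weight_pos hy)).le
            rw [mul_pow, ← ENNReal.ofReal_pow (Real.sqrt_nonneg _), Real.sq_sqrt h4]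
        _ ≤ _ := by
            rw [h3]
            exact mul_le_mul_right (setLIntegral_le_lintegral _ _) _
    rw [← hA]
    refine (pow_le_pow_left' (enorm_integral_le_lintegral_enorm _) 2).trans ?_
    refine le_trans (le_of_eq ?_) ((sq_lintegral_mul_le
      (f := fun y : Space d × Space d => ‖F₁ y.1 * F₂ y.2‖ₑ * ENNReal.ofReal √(weight s y))
      (hF.enorm.mul (by fun_prop)) (by fun_prop)).trans (mul_le_mul_right hB _))
    congr 1
    refine lintegral_congr_ae ?_
    filter_upwards [hae] with y hy
    have hwy := weight_pos hy
    have h1 : ENNReal.ofReal √(weight s y) * ENNReal.ofReal √(invWeight s y) = 1 := by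
      rw [← ENNReal.ofReal_mul (Real.sqrt_nonneg _), ← Real.sqrt_mul hwy.le, invWeight_eq,
        mul_inv_cancel₀ hwy.ne', Real.sqrt_one, ENNReal.ofReal_one]
    rw [enorm_mul, ← mul_assoc, mul_assoc ‖F₁ y.1 * F₂ y.2‖ₑ, h1, mul_one]
  rw [h₁.integral_spaceTime_mul h₂, enorm_mul, mul_pow, ← ofReal_norm
    ((((2 * Real.pi) ^ (2 * d))⁻¹ : ℝ) : ℂ), Complex.norm_real, Real.norm_of_nonneg (by positivity),
    ← ENNReal.ofReal_pow (by positivity)]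
  simp_rw [← hX]
  refine (mul_le_mul_right hCS _).trans_eq ?_
  simp_rw [hX]
  rw [lintegral_sq_conjFourier, finrank_spaceTime, KG_eq, ENNReal.ofReal_mul (by positivity),
    ENNReal.ofReal_mul (by positivity)]
  ring

end Estimate
-- The extremisers and the finiteness of their weighted integral.
section Extremiser

variable {d : ℕ}

/-- The kernel `K_s(y₁, y₂)` as a function of the energy-momentum vector. -/
noncomputable def energyKernel (d : ℕ) (s : ℝ) (z : ℝ × Space d) : ℝ :=
  ((z.1 ^ 2 - ‖z.2‖ ^ 2) / 2 - s ^ 2 - s ^ 2) ^ (((d : ℝ) - 2) / 2) /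
    ((z.1 ^ 2 - ‖z.2‖ ^ 2) / 2) ^ ((1 : ℝ) / 2)

lemma energyKernel_energyMomentum (s : ℝ) (y : Space d × Space d) :
    energyKernel d s (energyMomentum s y) = kernel s y.1 y.2 := by
  rw [energyKernel, energyMomentum, sq_energy_sub_sq_momentum, kernel_eq,
    mul_div_cancel_left₀ _ two_ne_zero, add_sub_cancel_right]

lemma measurable_energyKernel (d : ℕ) (s : ℝ) : Measurable (energyKernel d s) := by
  unfold energyKernel; fun_prop

lemma extremiserHat_eq (s a : ℝ) (ξ : Space d) :
    extremiserHat s a ξ = ((Real.exp (-(a * phi s ‖ξ‖)) / phi s ‖ξ‖ : ℝ) : ℂ) := rfl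

/-- In polar coordinates the integrand is r^{d-2} e^{-ar}, a Gamma integral since d ≥ 2. It
dominates the extremiser for every s. -/
lemma integrable_exp_neg_mul_norm_div (hd : 2 ≤ d) {a : ℝ} (ha : 0 < a) :
    Integrable (fun ξ : Space d => Real.exp (-(a * ‖ξ‖)) / ‖ξ‖) := by
  have : Nontrivial (Space d) := Module.nontrivial_of_finrank_pos (R := ℝ)
    (by rw [finrank_euclideanSpace_fin]; omega)
  rw [integrable_fun_norm_addHaar volume (f := fun r : ℝ => Real.exp (-(a * r)) / r),
    finrank_euclideanSpace_fin]
  have h1 := integrableOn_rpow_mul_exp_neg_mul_rpow (s := ((d - 2 : ℕ) : ℝ)) (p := 1) (b := a)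
    (by have : (0 : ℝ) ≤ ((d - 2 : ℕ) : ℝ) := by positivity
        linarith) one_pos ha
  refine h1.congr_fun (fun r hr => ?_) measurableSet_Ioi
  have hr' : (0 : ℝ) < r := hr
  obtain ⟨k, rfl⟩ := Nat.exists_eq_add_of_le hd
  simp only [Real.rpow_one, Real.rpow_natCast, smul_eq_mul, add_tsub_cancel_left,
    show 2 + k - 1 = k + 1 by omega, neg_mul, pow_succ]
  field_simp

lemma integrable_exp_neg_mul_phi_div (hd : 2 ≤ d) (s : ℝ) {a : ℝ} (ha : 0 < a) :
    Integrable (fun ξ : Space d => Real.exp (-(a * phi s ‖ξ‖)) / phi s ‖ξ‖) := by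
  have hc := (continuous_phi s).measurable
  have : Nontrivial (Space d) := Module.nontrivial_of_finrank_pos (R := ℝ)
    (by rw [finrank_euclideanSpace_fin]; omega)
  have hm : Measurable fun ξ : Space d => Real.exp (-(a * phi s ‖ξ‖)) / phi s ‖ξ‖ := by fun_prop
  refine (integrable_exp_neg_mul_norm_div hd ha).mono' hm.aestronglyMeasurable ?_
  have h0 : ∀ᵐ y : Space d, y ≠ 0 := by simp [ae_iff]
  filter_upwards [h0] with ξ hξ
  have h1 := phi_nonneg s ‖ξ‖
  have h2 : 0 < ‖ξ‖ := norm_pos_iff.2 hξ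
  have h3 := le_phi s ‖ξ‖
  rw [Real.norm_of_nonneg (by positivity)]
  gcongr

lemma integrable_extremiserHat (hd : 2 ≤ d) (s : ℝ) {a : ℝ} (ha : 0 < a) :
    Integrable (extremiserHat s a : Space d → ℂ) :=
  (integrable_exp_neg_mul_phi_div hd s ha).ofReal

lemma isPropagation_wave (s : ℝ) {g : Space d → ℂ} (hg : Integrable g) :
    IsPropagation s (fun x => wave s g (0, x)) g (wave s g) where
  memL1AddL2 := ⟨g, 0, memLp_one_iff_integrable.2 hg, MemLp.zero, (add_zero g).symm⟩
  hasFourierTransform := by simpa using hasFourierTransform_wave s hg 0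
  measurable := (continuous_wave s hg).aestronglyMeasurable
  evolution := hasFourierTransform_wave s hg

/-- Equality in the bilinear estimate for the extremisers. -/
lemma IsPropagation.productNormSq_extremiser (hd : 2 ≤ d) {s a : ℝ} {f₁ f₂ : Space d → ℂ}
    {u₁ u₂ : ℝ × Space d → ℂ} (h₁ : IsPropagation s f₁ (extremiserHat s a) u₁)
    (h₂ : IsPropagation s f₂ (extremiserHat s a) u₂) :
    productNormSq u₁ u₂ = ENNReal.ofReal (KG d) *
      weightedIntegral s (extremiserHat (d := d) s a) (extremiserHat s a) := by
  have hae := ae_mem_nonparallel hd s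
  have hm := measurable_energyKernel d s
  -- The exponentials multiply to e^{-aτ} with τ the total energy. The 1/(φ_s φ_s) of the data is
  -- the inverse weight times the kernel, whence the factor `energyKernel` in `G`.
  rw [h₁.productNormSq_eq_of_fiberwise (by omega) h₂ (r := 1)
    (A := fun y => extremiserHat s a y.1 * extremiserHat s a y.2)
    (G := fun z => ((Real.exp (-(a * z.1)) * energyKernel d s z : ℝ) : ℂ)) one_pos (by fun_prop)]
  · rw [weightedIntegral_eq, one_pow, mul_one]
    congr 1
    rw [Measure.restrict_eq_self_of_ae_mem hae]
  · intro y hy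
    obtain ⟨p1, p2⟩ := phi_mul_phi_pos hy
    have hk := kernel_pos hy
    rw [energyKernel_energyMomentum, extremiserHat_eq, extremiserHat_eq, invWeight,
      energyMomentum]
    norm_cast
    rw [mul_add, neg_add, Real.exp_add]
    field_simp
  · filter_upwards [hae] with y hy hy'
    exact absurd hy hy'
  · intro X
    refine ⟨integrable_mul_energyMomentum s h₁.memL1AddL2 h₂.memL1AddL2 X, ?_⟩
    rw [Complex.ofReal_one, one_mul]

lemma minkowski_le (s : ℝ) (y : Space d × Space d) :
    minkowski s y.1 y.2 ≤ (phi s ‖y.1‖ + phi s ‖y.2‖) ^ 2 := by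
  have h1 := le_phi s ‖y.1‖
  have h2 := le_phi s ‖y.2‖
  have h3 := neg_le_of_abs_le (abs_real_inner_le_norm y.1 y.2)
  have h4 : ‖y.1‖ * ‖y.2‖ ≤ phi s ‖y.1‖ * phi s ‖y.2‖ :=
    mul_le_mul h1 h2 (norm_nonneg _) (phi_nonneg _ _)
  rw [minkowski]
  nlinarith [sq_nonneg (phi s ‖y.1‖), sq_nonneg (phi s ‖y.2‖)]

lemma rpow_half_le {p τ : ℝ} (hp : 0 ≤ p) (hτ : 0 ≤ τ) (h : p ≤ τ ^ 2) (n : ℕ) :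
    p ^ ((n : ℝ) / 2) ≤ τ ^ n := by
  calc p ^ ((n : ℝ) / 2) ≤ (τ ^ 2) ^ ((n : ℝ) / 2) := by gcongr
    _ = τ ^ n := by
      rw [← Real.rpow_natCast τ 2, ← Real.rpow_mul hτ, ← Real.rpow_natCast τ n]
      congr 1
      push_cast
      ring

/-- For s = 0 the two powers combine to exponent (d-3)/2, which is nonnegative once d ≥ 3. For s ≠ 0
the denominator is at least |s|. In the excluded case the kernel is the power -1/2 of `minkowski`,
unbounded near parallel momenta. -/
lemma exists_kernel_le (hd : 2 ≤ d) {s : ℝ} (h : ¬ (d = 2 ∧ s = 0)) :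
    ∃ (C : ℝ) (n : ℕ), 0 ≤ C ∧ ∀ y ∈ nonparallel d s,
      kernel s y.1 y.2 ≤ C * (phi s ‖y.1‖ + phi s ‖y.2‖) ^ n := by
  by_cases hs : s = 0
  · have hd3 : 3 ≤ d := by
      have : d ≠ 2 := fun h2 => h ⟨h2, hs⟩
      omega
    obtain ⟨k, rfl⟩ := Nat.exists_eq_add_of_le hd3
    refine ⟨1, k, zero_le_one, fun y hy => ?_⟩
    have hy' : s ^ 2 < minkowski s y.1 y.2 := hy
    have hτ := add_nonneg (phi_nonneg s ‖y.1‖) (phi_nonneg s ‖y.2‖)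
    have hle := minkowski_le s y
    rw [kernel_eq, hs] at *
    simp only [ne_eq, OfNat.ofNat_ne_zero, not_false_eq_true, zero_pow, sub_zero, add_zero] at *
    rw [← Real.rpow_sub hy', one_mul]
    refine le_trans (le_of_eq ?_) (rpow_half_le hy'.le hτ hle k)
    congr 1
    push_cast
    ring
  · obtain ⟨k, rfl⟩ := Nat.exists_eq_add_of_le hd
    have hs2 : 0 < s ^ 2 := by positivity
    refine ⟨((s ^ 2) ^ ((1 : ℝ) / 2))⁻¹, k, by positivity, fun y hy => ?_⟩
    have hy' : s ^ 2 < minkowski s y.1 y.2 := hy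
    have hτ := add_nonneg (phi_nonneg s ‖y.1‖) (phi_nonneg s ‖y.2‖)
    have hle := minkowski_le s y
    rw [kernel_eq, div_eq_inv_mul]
    have h1 : (minkowski s y.1 y.2 - s ^ 2) ^ ((((2 + k : ℕ) : ℝ) - 2) / 2) ≤
        (phi s ‖y.1‖ + phi s ‖y.2‖) ^ k := by
      refine le_trans (le_of_eq ?_) (rpow_half_le (p := minkowski s y.1 y.2 - s ^ 2)
        (by linarith) hτ (by linarith) k)
      congr 1
      push_cast
      ring
    have h2 : (0 : ℝ) ≤ (minkowski s y.1 y.2 - s ^ 2) ^ ((((2 + k : ℕ) : ℝ) - 2) / 2) :=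
      Real.rpow_nonneg (by linarith) _
    gcongr
    linarith

/-- The squared data decay like e^{-2a(P+Q)}, with P and Q the two energies. Half of this decay pays
for the polynomial growth of the kernel, by x^n ≤ n! e^x, and the other half leaves the integrable
product of two extremisers. -/
lemma weightedIntegral_extremiserHat_ne_top (hd : 2 ≤ d) {s a : ℝ} (h : ¬ (d = 2 ∧ s = 0))
    (ha : 0 < a) :
    weightedIntegral s (extremiserHat (d := d) s a) (extremiserHat s a) ≠ ⊤ := by
  obtain ⟨C, n, hC, hK⟩ := exists_kernel_le hd h
  have hi := integrable_exp_neg_mul_phi_div hd s ha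
  have hprod := (hi.mul_prod hi).const_mul (C * (n.factorial / a ^ n))
  refine ((lintegral_mono_ae ?_).trans_lt hprod.2).ne
  filter_upwards [ae_mem_nonparallel hd s] with y hy
  obtain ⟨p1, p2⟩ := phi_mul_phi_pos hy
  have hk := kernel_pos hy
  have hKy := hK y hy
  rw [extremiserHat_eq, extremiserHat_eq, Complex.norm_real, Complex.norm_real,
    ← ofReal_norm]
  set P := phi s ‖y.1‖
  set Q := phi s ‖y.2‖
  refine ENNReal.ofReal_le_ofReal ?_
  rw [Real.norm_of_nonneg (by positivity), Real.norm_of_nonneg (by positivity),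
    Real.norm_of_nonneg (by positivity)]
  have h1 := Real.pow_div_factorial_le_exp (a * (P + Q)) (by positivity) n
  have h2 : (P + Q) ^ n ≤ n.factorial / a ^ n * Real.exp (a * (P + Q)) := by
    rw [mul_pow] at h1
    rw [div_mul_eq_mul_div, le_div_iff₀ (by positivity)]
    rw [div_le_iff₀ (by positivity)] at h1
    linarith
  have h3 : kernel s y.1 y.2 ≤ C * (n.factorial / a ^ n * Real.exp (a * (P + Q))) :=
    hKy.trans (by gcongr)
  have h4 : Real.exp (a * (P + Q)) * Real.exp (-(a * P)) * Real.exp (-(a * Q)) = 1 := by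
    rw [← Real.exp_add, ← Real.exp_add, ← Real.exp_zero]
    congr 1; ring
  calc _ ≤ (Real.exp (-(a * P)) / P) ^ 2 * (Real.exp (-(a * Q)) / Q) ^ 2 * P * Q *
        (C * (n.factorial / a ^ n * Real.exp (a * (P + Q)))) := by gcongr
    _ = C * (n.factorial / a ^ n) * (Real.exp (-(a * P)) / P * (Real.exp (-(a * Q)) / Q)) *
        (Real.exp (a * (P + Q)) * Real.exp (-(a * P)) * Real.exp (-(a * Q))) := by
        field_simp
    _ = _ := by rw [h4, mul_one]

lemma weightedIntegral_extremiserHat_ne_zero (hd : 2 ≤ d) (s a : ℝ) :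
    weightedIntegral s (extremiserHat (d := d) s a) (extremiserHat s a) ≠ 0 := by
  have hw := measurable_weight (d := d) s
  have hphi := (continuous_phi s).measurable
  have he : Measurable (extremiserHat s a : Space d → ℂ) := by
    unfold extremiserHat
    fun_prop
  rw [weightedIntegral_eq]
  intro h0
  rw [lintegral_eq_zero_iff (by fun_prop)] at h0
  have : ∀ᵐ y : Space d × Space d, False := by
    filter_upwards [h0, ae_mem_nonparallel hd s] with y h1 hy
    obtain ⟨p1, p2⟩ := phi_mul_phi_pos hy
    have hwy := weight_pos hy
    have e1 := Real.exp_pos (-(a * phi s ‖y.1‖))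
    have e2 := Real.exp_pos (-(a * phi s ‖y.2‖))
    simp [extremiserHat_eq, p1.ne', p2.ne', hwy.not_ge] at h1
  exact this.exists.elim fun _ h => h

end Extremiser
-- The identity on the line.
section OneDimension

lemma norm_space_one (y : Space 1) : ‖y‖ = |y 0| := by
  rw [EuclideanSpace.norm_eq, Fin.sum_univ_one, Real.norm_eq_abs, sq_abs, Real.sqrt_sq_eq_abs]

lemma inner_space_one (y₁ y₂ : Space 1) : (inner ℝ y₁ y₂ : ℝ) = y₁ 0 * y₂ 0 := by
  simp [PiLp.inner_apply, mul_comm]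

lemma phi_sq_space_one (s : ℝ) (y : Space 1) : phi s ‖y‖ ^ 2 = s ^ 2 + y 0 ^ 2 := by
  rw [phi_sq, norm_space_one, sq_abs]

lemma minkowski_space_one (s : ℝ) (y₁ y₂ : Space 1) :
    minkowski s y₁ y₂ = phi s ‖y₁‖ * phi s ‖y₂‖ - y₁ 0 * y₂ 0 := by
  rw [minkowski, inner_space_one]

/-- Rests on (s² + p²)(s² + q²) = (s² + pq)² + s²(p - q)². -/
lemma mem_nonparallel_of_ne {s : ℝ} (hs : 0 < s) {y : Space 1 × Space 1} (h : y.1 ≠ y.2) :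
    y ∈ nonparallel 1 s := by
  have h0 : y.1 0 ≠ y.2 0 := fun h0 => h (by ext i; fin_cases i; exact h0)
  change s ^ 2 < minkowski s y.1 y.2
  rw [minkowski_space_one]
  have h1 : (s ^ 2 + y.1 0 * y.2 0) ^ 2 < (phi s ‖y.1‖ * phi s ‖y.2‖) ^ 2 := by
    rw [mul_pow, phi_sq_space_one, phi_sq_space_one]
    have : 0 < s ^ 2 * (y.1 0 - y.2 0) ^ 2 := by
      have := sub_ne_zero.2 h0
      positivity
    linarith [show (s ^ 2 + y.1 0 ^ 2) * (s ^ 2 + y.2 0 ^ 2) = (s ^ 2 + y.1 0 * y.2 0) ^ 2 +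
      s ^ 2 * (y.1 0 - y.2 0) ^ 2 by ring]
  have h2 := lt_of_pow_lt_pow_left₀ 2 (mul_nonneg (phi_nonneg s ‖y.1‖) (phi_nonneg s ‖y.2‖)) h1
  linarith

lemma mem_nonparallel_zero_of_mul_neg {y : Space 1 × Space 1} (h : y.1 0 * y.2 0 < 0) :
    y ∈ nonparallel 1 0 := by
  change (0 : ℝ) ^ 2 < minkowski 0 y.1 y.2
  rw [minkowski_space_one]
  have := mul_nonneg (phi_nonneg 0 ‖y.1‖) (phi_nonneg 0 ‖y.2‖)
  norm_num
  linarith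

/-- Half of the distance of the two momenta on the line, as a function of energy and momentum. -/
noncomputable def halfGap (s : ℝ) (z : ℝ × Space 1) : ℝ :=
  z.1 / 2 * √((z.1 ^ 2 - ‖z.2‖ ^ 2 - 4 * s ^ 2) / (z.1 ^ 2 - ‖z.2‖ ^ 2))

/-- The ordered pair of momenta on the line with given energy and momentum. -/
noncomputable def momenta (s : ℝ) (z : ℝ × Space 1) : Space 1 × Space 1 :=
  ((2⁻¹ : ℝ) • z.2 - halfGap s z • EuclideanSpace.single 0 1,
    (2⁻¹ : ℝ) • z.2 + halfGap s z • EuclideanSpace.single 0 1)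

lemma measurable_momenta (s : ℝ) : Measurable (momenta s) := by
  have : Measurable (halfGap s) := by unfold halfGap; fun_prop
  unfold momenta
  fun_prop

/-- With energies P, Q and B = `minkowski`, the mass shell relations give (P + Q)²(B - s²) = (y₂ -
y₁)²(B + s²), so energy and momentum determine |y₂ - y₁|. -/
lemma halfGap_energyMomentum {s : ℝ} {y : Space 1 × Space 1} (hy : y ∈ nonparallel 1 s) :
    halfGap s (energyMomentum s y) = |y.2 0 - y.1 0| / 2 := by
  have h : s ^ 2 < minkowski s y.1 y.2 := hy
  have hp := phi_mul_phi_pos hy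
  have e1 := phi_sq_space_one s y.1
  have e2 := phi_sq_space_one s y.2
  rw [halfGap, energyMomentum, sq_energy_sub_sq_momentum]
  have hB := minkowski_space_one s y.1 y.2
  set P := phi s ‖y.1‖
  set Q := phi s ‖y.2‖
  set B := minkowski s y.1 y.2
  have hBs : 0 < B + s ^ 2 := by nlinarith
  have h1 : (P + Q) ^ 2 * (B - s ^ 2) = (y.2 0 - y.1 0) ^ 2 * (B + s ^ 2) := by
    have e3 : (P * Q) ^ 2 = (s ^ 2 + y.1 0 ^ 2) * (s ^ 2 + y.2 0 ^ 2) := by rw [mul_pow, e1, e2]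
    rw [hB]
    linear_combination (P * Q - y.1 0 * y.2 0 - s ^ 2) * (e1 + e2) + 2 * e3
  have h2 : (2 * (B + s ^ 2) - 4 * s ^ 2) / (2 * (B + s ^ 2)) =
      (|y.2 0 - y.1 0| / (P + Q)) ^ 2 := by
    have := hp.1
    have := hp.2
    rw [div_pow, sq_abs, div_eq_div_iff (by positivity) (by positivity)]
    linear_combination 2 * h1
  have hpq : 0 < P + Q := add_pos hp.1 hp.2
  rw [h2, Real.sqrt_sq (by positivity)]
  field_simp

lemma momenta_energyMomentum {s : ℝ} {y : Space 1 × Space 1} (hy : y ∈ nonparallel 1 s) :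
    momenta s (energyMomentum s y) = y ∨ momenta s (energyMomentum s y) = y.swap := by
  rw [momenta, halfGap_energyMomentum hy]
  rcases le_total (y.1 0) (y.2 0) with h | h
  · left
    rw [abs_of_nonneg (sub_nonneg.2 h)]
    refine Prod.ext ?_ ?_ <;> ext i <;> fin_cases i <;> simp [energyMomentum] <;> ring
  · right
    rw [abs_of_nonpos (sub_nonpos.2 h)]
    refine Prod.ext ?_ ?_ <;> ext i <;> fin_cases i <;> simp [energyMomentum] <;> ring

lemma energyMomentum_swap {d : ℕ} (s : ℝ) (y : Space d × Space d) :
    energyMomentum s y.swap = energyMomentum s y := by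
  simp [energyMomentum, add_comm]

lemma weight_swap {d : ℕ} (s : ℝ) (y : Space d × Space d) : weight s y.swap = weight s y := by
  simp only [weight, kernel, Prod.fst_swap, Prod.snd_swap]
  rw [real_inner_comm, mul_comm (phi s ‖y.2‖)]

lemma swap_mem_nonparallel {d : ℕ} {s : ℝ} {y : Space d × Space d} :
    y.swap ∈ nonparallel d s ↔ y ∈ nonparallel d s := by
  simp only [nonparallel, minkowski, Set.mem_ofPred_eq, Prod.fst_swap, Prod.snd_swap]
  rw [real_inner_comm, mul_comm (phi s ‖y.2‖)]

/-- The identity in one dimension. -/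
lemma IsPropagation.productNormSq_one {s : ℝ} {f₁ f₂ F₁ F₂ : Space 1 → ℂ}
    {u₁ u₂ : ℝ × Space 1 → ℂ} (h₁ : IsPropagation s f₁ F₁ u₁) (h₂ : IsPropagation s f₂ F₂ u₂)
    (hsupp : ∀ y₁ y₂, F₁ y₁ ≠ 0 → F₂ y₂ ≠ 0 → (y₁, y₂) ∈ nonparallel 1 s)
    (hdisj : ∀ y, F₁ y ≠ 0 → F₂ y = 0) :
    productNormSq u₁ u₂ = ENNReal.ofReal (KG 1 / 2) * weightedIntegral s F₁ F₂ := by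
  have hm₁ : AEStronglyMeasurable F₁ volume := by
    obtain ⟨g, k, hg, hk, rfl⟩ := h₁.memL1AddL2
    exact hg.1.add hk.1
  have hm₂ : AEStronglyMeasurable F₂ volume := by
    obtain ⟨g, k, hg, hk, rfl⟩ := h₂.memL1AddL2
    exact hg.1.add hk.1
  have hmk₁ := hm₁.stronglyMeasurable_mk.measurable
  have hmk₂ := hm₂.stronglyMeasurable_mk.measurable
  -- The symmetrisation is constant on the fibres {y, swap y} of `energyMomentum`. Measurable
  -- representatives are used because `G` has to be measurable as a function of energy and momentum.
  let A : Space 1 × Space 1 → ℂ := fun y => hm₁.mk F₁ y.1 * hm₂.mk F₂ y.2 +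
    hm₁.mk F₁ y.2 * hm₂.mk F₂ y.1
  have hAm : Measurable A := by fun_prop
  have hAswap (y : Space 1 × Space 1) : A y.swap = A y := by simp only [A, Prod.fst_swap, Prod.snd_swap]; ring
  have hAae : ∀ᵐ y : Space 1 × Space 1, A y = F₁ y.1 * F₂ y.2 + F₁ y.2 * F₂ y.1 := by
    have q1 : Measure.QuasiMeasurePreserving (Prod.fst : Space 1 × Space 1 → Space 1) volume volume :=
      Measure.quasiMeasurePreserving_fst
    have q2 : Measure.QuasiMeasurePreserving (Prod.snd : Space 1 × Space 1 → Space 1) volume volume :=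
      Measure.quasiMeasurePreserving_snd
    filter_upwards [q1.ae hm₁.ae_eq_mk, q2.ae hm₁.ae_eq_mk, q1.ae hm₂.ae_eq_mk,
      q2.ae hm₂.ae_eq_mk] with y e1 e2 e3 e4
    simp only [A]
    rw [e1, e2, e3, e4]
  have hzero (y : Space 1 × Space 1) (hy : y ∉ nonparallel 1 s) : F₁ y.1 * F₂ y.2 = 0 := by
    by_contra h
    exact hy (hsupp _ _ (left_ne_zero_of_mul h) (right_ne_zero_of_mul h))
  have hA0 : ∀ᵐ y, y ∉ nonparallel 1 s → A y = 0 := by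
    filter_upwards [hAae] with y hy hn
    have hz := hzero y.swap (fun h => hn (swap_mem_nonparallel.1 h))
    rw [Prod.fst_swap, Prod.snd_swap] at hz
    rw [hy, hzero y hn, hz, add_zero]
  have hw := measurable_weight (d := 1) s
  have hmom := measurable_momenta s
  -- Both halves of `A` pair equally with functions of energy and momentum, whence r = 1/2. The
  -- constant becomes KG(1)/4, and the integral of |A|² times the weight is twice the weighted
  -- integral.
  rw [h₁.productNormSq_eq_of_fiberwise le_rfl h₂ (r := 1 / 2) (A := A)
    (G := fun z => A (momenta s z) * (weight s (momenta s z) : ℂ)) (by norm_num) (by fun_prop)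
    ?_ hA0 ?_]
  · have hsq : ∫⁻ y in nonparallel 1 s, ‖A y‖ₑ ^ 2 * ENNReal.ofReal (weight s y) =
        2 * weightedIntegral s F₁ F₂ := by
      set g : Space 1 × Space 1 → ℝ≥0∞ := fun y =>
        ‖F₁ y.1 * F₂ y.2‖ₑ ^ 2 * ENNReal.ofReal (weight s y) with hg
      have hgm : AEMeasurable g volume :=
        ((aestronglyMeasurable_prod_mul hm₁ hm₂).enorm.pow_const 2).mul (by fun_prop)
      have hswap : ∫⁻ y : Space 1 × Space 1, g y.swap = ∫⁻ y, g y := by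
        rw [Measure.volume_eq_prod]
        exact lintegral_prod_swap g
      rw [weightedIntegral_eq, two_mul]
      conv_rhs => enter [2]; rw [← hswap]
      rw [← lintegral_add_left' hgm, ← lintegral_indicator (measurableSet_nonparallel 1 s)]
      refine lintegral_congr_ae ?_
      filter_upwards [hAae, hA0] with y hy hy0
      -- No cross term: at each y at most one of the two products is non-zero.
      have key : ‖A y‖ₑ ^ 2 * ENNReal.ofReal (weight s y) = g y + g y.swap := by
        simp only [hg, weight_swap, Prod.fst_swap, Prod.snd_swap]
        rw [hy, ← add_mul]
        by_cases h : F₁ y.1 * F₂ y.2 = 0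
        · simp [h]
        · rw [hdisj _ (left_ne_zero_of_mul h)]
          simp
      rw [← key]
      by_cases hn : y ∈ nonparallel 1 s
      · rw [Set.indicator_of_mem hn]
      · rw [Set.indicator_of_notMem hn, hy0 hn]
        simp
    rw [hsq, ← mul_assoc, ← ENNReal.ofReal_ofNat 2, ← ENNReal.ofReal_mul
      (by have := KG_pos (d := 1) le_rfl; positivity)]
    congr 2
    ring
  · intro y hy
    have hwy : (weight s y : ℂ) ≠ 0 := by exact_mod_cast (weight_pos hy).ne'
    rw [invWeight_eq]
    push_cast
    rcases momenta_energyMomentum hy with h | h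
    · rw [h]; field_simp
    · rw [h, hAswap, weight_swap]; field_simp
  · intro X
    have hI := integrable_mul_energyMomentum s h₁.memL1AddL2 h₂.memL1AddL2 X
    have hI' : Integrable (fun y : Space 1 × Space 1 =>
        F₁ y.2 * F₂ y.1 * X (WithLp.toLp 2 (energyMomentum s y))) := by
      have := hI.swap
      refine this.congr (Filter.Eventually.of_forall fun y => ?_)
      simp only [Function.comp_apply, energyMomentum_swap, Prod.fst_swap, Prod.snd_swap]
    have hae : (fun y => A y * X (WithLp.toLp 2 (energyMomentum s y))) =ᵐ[volume] fun y =>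
        F₁ y.1 * F₂ y.2 * X (WithLp.toLp 2 (energyMomentum s y)) +
        F₁ y.2 * F₂ y.1 * X (WithLp.toLp 2 (energyMomentum s y)) := by
      filter_upwards [hAae] with y hy
      rw [hy, add_mul]
    have hsw : ∫ y : Space 1 × Space 1, F₁ y.2 * F₂ y.1 * X (WithLp.toLp 2 (energyMomentum s y)) =
        ∫ y : Space 1 × Space 1, F₁ y.1 * F₂ y.2 * X (WithLp.toLp 2 (energyMomentum s y)) := by
      have := integral_prod_swap (μ := (volume : Measure (Space 1)))
        (ν := (volume : Measure (Space 1))) (fun y : Space 1 × Space 1 =>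
          F₁ y.1 * F₂ y.2 * X (WithLp.toLp 2 (energyMomentum s y)))
      simp only [energyMomentum_swap, Prod.fst_swap, Prod.snd_swap] at this
      exact this
    refine ⟨(hI.add hI').congr hae.symm, ?_⟩
    rw [integral_congr_ae hae, integral_add hI hI', hsw]
    push_cast
    ring

end OneDimension

end KleinGordon

theorem theorem1 :
    (∀ (d : ℕ) (s : ℝ), 2 ≤ d → 0 ≤ s →
      -- the inequality
      (∀ (f₁ f₂ fhat₁ fhat₂ : KleinGordon.Space d → ℂ) (u₁ u₂ : ℝ × KleinGordon.Space d → ℂ),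
        KleinGordon.IsPropagation s f₁ fhat₁ u₁ → KleinGordon.IsPropagation s f₂ fhat₂ u₂ →
        KleinGordon.productNormSq u₁ u₂ ≤
          ENNReal.ofReal (KleinGordon.KG d) * KleinGordon.weightedIntegral s fhat₁ fhat₂) ∧
      -- equality for the extremisers
      (∀ a : ℝ, 0 < a →
        (∃ (f : KleinGordon.Space d → ℂ) (u : ℝ × KleinGordon.Space d → ℂ),
          KleinGordon.IsPropagation s f (KleinGordon.extremiserHat s a) u) ∧
        (∀ (f₁ f₂ : KleinGordon.Space d → ℂ) (u₁ u₂ : ℝ × KleinGordon.Space d → ℂ),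
          KleinGordon.IsPropagation s f₁ (KleinGordon.extremiserHat s a) u₁ →
          KleinGordon.IsPropagation s f₂ (KleinGordon.extremiserHat s a) u₂ →
          KleinGordon.productNormSq u₁ u₂ =
            ENNReal.ofReal (KleinGordon.KG d) *
              KleinGordon.weightedIntegral s (KleinGordon.extremiserHat (d := d) s a)
                (KleinGordon.extremiserHat s a)) ∧
        (¬ (d = 2 ∧ s = 0) →
          KleinGordon.weightedIntegral s (KleinGordon.extremiserHat (d := d) s a)
            (KleinGordon.extremiserHat s a) ≠ 0 ∧
          KleinGordon.weightedIntegral s (KleinGordon.extremiserHat (d := d) s a)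
            (KleinGordon.extremiserHat s a) ≠ ⊤)) ∧
      -- the constant is best possible
      (¬ (d = 2 ∧ s = 0) → ∀ C : ℝ,
        (∀ (f₁ f₂ fhat₁ fhat₂ : KleinGordon.Space d → ℂ)
            (u₁ u₂ : ℝ × KleinGordon.Space d → ℂ),
          KleinGordon.IsPropagation s f₁ fhat₁ u₁ → KleinGordon.IsPropagation s f₂ fhat₂ u₂ →
          KleinGordon.productNormSq u₁ u₂ ≤
            ENNReal.ofReal C * KleinGordon.weightedIntegral s fhat₁ fhat₂) →
        KleinGordon.KG d ≤ C)) ∧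
    -- the identity in one dimension
    (∀ (s : ℝ) (f₁ f₂ fhat₁ fhat₂ : KleinGordon.Space 1 → ℂ)
        (u₁ u₂ : ℝ × KleinGordon.Space 1 → ℂ),
      KleinGordon.IsPropagation s f₁ fhat₁ u₁ → KleinGordon.IsPropagation s f₂ fhat₂ u₂ →
      ((0 < s ∧ Disjoint (Function.support fhat₁) (Function.support fhat₂)) ∨
        (s = 0 ∧ ∀ y₁ ∈ Function.support fhat₁, ∀ y₂ ∈ Function.support fhat₂,
          y₁ 0 * y₂ 0 < 0)) →
      KleinGordon.productNormSq u₁ u₂ =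
        ENNReal.ofReal (KleinGordon.KG 1 / 2) *
          KleinGordon.weightedIntegral s fhat₁ fhat₂) := by
  refine ⟨fun d s hd hs => ⟨?_, ?_, ?_⟩, ?_⟩
  · intro f₁ f₂ F₁ F₂ u₁ u₂ h₁ h₂
    exact h₁.productNormSq_le hd h₂
  · intro a ha
    refine ⟨⟨_, _, KleinGordon.isPropagation_wave s
      (KleinGordon.integrable_extremiserHat hd s ha)⟩, ?_, fun h => ?_⟩
    · intro f₁ f₂ u₁ u₂ h₁ h₂
      exact h₁.productNormSq_extremiser hd h₂
    · exact ⟨KleinGordon.weightedIntegral_extremiserHat_ne_zero hd s a,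
        KleinGordon.weightedIntegral_extremiserHat_ne_top hd h ha⟩
  · intro h C hC
    have hp := KleinGordon.isPropagation_wave s
      (KleinGordon.integrable_extremiserHat hd s one_pos)
    have h1 := hC _ _ _ _ _ _ hp hp
    -- Equality at the extremiser with a = 1, whose weighted integral is finite and non-zero and can
    -- be cancelled.
    rw [hp.productNormSq_extremiser hd hp,
      ENNReal.mul_le_mul_iff_left (KleinGordon.weightedIntegral_extremiserHat_ne_zero hd s 1)
        (KleinGordon.weightedIntegral_extremiserHat_ne_top hd h one_pos)] at h1
    -- `ENNReal.ofReal` sends negative numbers to 0, so KG(d) > 0 is needed to recover the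
    -- comparison of real constants.
    exact (ENNReal.ofReal_le_ofReal_iff'.1 h1).resolve_right
      (not_le.2 (KleinGordon.KG_pos (by omega)))
  · intro s f₁ f₂ F₁ F₂ u₁ u₂ h₁ h₂ h
    refine h₁.productNormSq_one h₂ (fun y₁ y₂ hy₁ hy₂ => ?_) fun y hy => ?_
    · rcases h with ⟨hs, h⟩ | ⟨rfl, h⟩
      · refine KleinGordon.mem_nonparallel_of_ne hs fun h0 => ?_
        have h0' : y₁ = y₂ := h0
        exact Set.disjoint_left.1 h hy₁ (h0' ▸ hy₂)
      · exact KleinGordon.mem_nonparallel_zero_of_mul_neg (h y₁ hy₁ y₂ hy₂)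
    · by_contra hy'
      rcases h with ⟨-, h⟩ | ⟨-, h⟩
      · exact Set.disjoint_left.1 h hy hy'
      · exact absurd (h y hy y hy') (not_lt.2 (mul_self_nonneg _))
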